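/- **Proposition 4.3.** Let $(G,d)$ be a compact metric group, i.e. a group $G$ with identity $e$ and a metric $d$ satisfying $d(gx,gy)=d(x,y)=d(xg,yg)$ for all $g,x,y\in G$, such that $(G,d)$ is compact. *Quantum metric spaces.* An order-unit space is a real ordered vector space $A$ with an element $1$ such that every $a\in A$ satisfies $a\le r1$ for some $r\in\mathbb R$, and $a\le 0$ whenever $a\le r1$ for all $r>0$. An order-unit morphism is a linear map preserving the order and the unit; a state is an order-unit morphism to $\mathbb R$, and $S(A)$ is the set of states. A Lip-norm on $A$ is a (finite) seminorm $L$ such that $L(a)=0$ iff $a\in\mathbb R1$, and such that $d_L(\sigma,\tau)=\sup\{|\sigma(a)-\tau(a)|: L(a)\le 1\}$ is a metric on $S(A)$ inducing the weak$^*$ topology. Then $(A,L)$ is called a quantum metric space, and $S(A,L)=(S(A),d_L)$ is a compact metric space. A morphism $(A,L_A)\to(B,L_B)$ of quantum metric spaces is an order-unit morphism $\phi$ with $L_B(\phi(a))\le L_A(a)$ for all $a\in A$. *The group and its truncations.* Let $\mathcal A$ be the order-unit space of real-valued Lipschitz functions on $G$ (with the pointwise order and the constant function $1$) and let $L(f)$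 be the lowest Lipschitz constant of $f$. Let $L^2(G)$ be the complex $L^2$-space of the normalized Haar measure, on which $\mathcal A$ acts by multiplication, and put $(U_g\psi)(x)=\psi(g^{-1}x)$, $(V_g\psi)(x)=\psi(xg)$, $\lambda_g(T)=U_gTU_g^*$, $\rho_g(T)=V_gTV_g^*$ for bounded operators $T$ on $L^2(G)$, and $$\|T\|_\lambda=\sup_{x\ne y}\frac{\|\lambda_x(T)-\lambda_y(T)\|}{d(x,y)},\qquad \|T\|_\rho=\sup_{x\ne y}\frac{\|\rho_x(T)-\rho_y(T)\|}{d(x,y)}.$$ Let $\widehat G$ be the set of equivalence classes of irreducible unitary representations of $G$. For a finite subset $\Lambda\subseteq\widehat G$ let $P_\Lambda$ be the orthogonal projection of $L^2(G)$ onto $L^2(G)_\Lambda=\bigoplus_{\nu\in\Lambda}E_\nu\otimes E_\nu^*$, where $E_\nu$ is the space of $\nu$ and $E_\nu\otimes E_\nu^*$ is identified with the span of the matrix coefficients $x\mapsto\varphi(\nu(x^{-1})v)$, $v\in E_\nu$, $\varphi\in E_\nu^*$. Put $\tau_\Lambda(f)=P_\Lambda fP_\Lambda$ for $f\in\mathcal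 A$, and $\mathcal A_\Lambda=\tau_\Lambda(\mathcal A)$, with the order of self-adjoint operators and the unit $P_\Lambda$; it is preserved by every $\rho_g$. Let $L_\Lambda(T)=\max(\|T\|_\lambda,\|T\|_\rho)$ for $T\in\mathcal A_\Lambda$. *Claim.* Let $\Lambda\subseteq\widehat G$ be finite, and let $\mu$ be a Borel probability measure on $G$ that is liftable to a state on $\mathcal A_\Lambda$, i.e. there is a (necessarily unique) state $\mu_\Lambda\in S(\mathcal A_\Lambda)$ with $\mu_\Lambda(\tau_\Lambda(f))=\int_G f\,d\mu$ for all $f\in\mathcal A$. Then $(\mathcal A_\Lambda,L_\Lambda)$ and $(\mathcal A,L)$ are quantum metric spaces with nonempty state spaces, the formula $$\upsilon_\Lambda^\mu(T)(g)=\mu_\Lambda(\rho_g(T)),\qquad T\in\mathcal A_\Lambda,\ g\in G,$$ defines a morphism of quantum metric spaces $\upsilon_\Lambda^\mu:(\mathcal A_\Lambda,L_\Lambda)\to(\mathcal A,L)$, and the Gromov–Hausdorff distance satisfies $$d_{GH}\big(S(\mathcal A_\Lambda,L_\Lambda),S(\mathcal A,L)\big)\le\int_G d(e,x)\,d\mu(x).$$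 -/

import Mathlib

open MeasureTheory
open scoped ENNReal NNReal

universe u

noncomputable section

/-! ### Order-unit spaces and their states -/

/-- A real ordered vector space whose element `1` is an archimedean order unit. -/
class OrderUnitSpace (A : Type*) [AddCommGroup A] [PartialOrder A] [Module ℝ A] [One A] : Prop
    extends IsOrderedAddMonoid A, IsOrderedModule ℝ A where
  exists_le_smul_one : ∀ a : A, ∃ r : ℝ, a ≤ r • (1 : A)
  le_zero_of_forall_le_smul_one : ∀ a : A, (∀ r : ℝ, 0 < r → a ≤ r • (1 : A)) → a ≤ 0

/-- Order-unit morphisms: linear maps that preserve the order and the unit. -/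
structure OrderUnitHom (A B : Type*) [AddCommGroup A] [PartialOrder A] [Module ℝ A] [One A]
    [AddCommGroup B] [PartialOrder B] [Module ℝ B] [One B] extends A →ₚ[ℝ] B where
  map_one' : toFun 1 = 1

instance {A B : Type*} [AddCommGroup A] [PartialOrder A] [Module ℝ A] [One A]
    [AddCommGroup B] [PartialOrder B] [Module ℝ B] [One B] :
    FunLike (OrderUnitHom A B) A B where
  coe φ := φ.toFun
  coe_injective φ ψ h := by
    rcases φ with ⟨φ, h₁⟩
    rcases ψ with ⟨ψ, h₂⟩
    congr
    exact DFunLike.coe_injective h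

section States

variable {A : Type*} [AddCommGroup A] [PartialOrder A] [Module ℝ A] [One A]

/-- States on `A`: order-unit morphisms `A → ℝ`. -/
abbrev State (A : Type*) [AddCommGroup A] [PartialOrder A] [Module ℝ A] [One A] : Type _ :=
  OrderUnitHom A ℝ

/-- The weak-* topology on the states: pointwise convergence on `A`. -/
instance State.instTopologicalSpace : TopologicalSpace (State A) :=
  TopologicalSpace.induced (fun (σ : State A) (a : A) => σ a) Pi.topologicalSpace

/-- The state space of an order-unit space is weak-* compact. -/
theorem State.compactSpace [OrderUnitSpace A] : CompactSpace (State A) := by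
  have hind : Topology.IsInducing (fun (σ : State A) (a : A) => σ a) := ⟨rfl⟩
  choose r hr using OrderUnitSpace.exists_le_smul_one (A := A)
  have hone : ∀ σ : State A, σ 1 = 1 := fun σ => σ.map_one'
  have hsmul : ∀ (σ : State A) (c : ℝ) (a : A), σ (c • a) = c * σ a :=
    fun σ c a => σ.map_smul' c a
  have hmono : ∀ (σ : State A) {a b : A}, a ≤ b → σ a ≤ σ b := fun σ _ _ h => σ.monotone' h
  have hle : ∀ (σ : State A) (a : A), σ a ≤ r a := fun σ a => by
    simpa [hsmul, hone] using hmono σ (hr a)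
  have hneg : ∀ (σ : State A) (a : A), σ (-a) = - σ a := fun σ a => by
    simpa using hsmul σ (-1) a
  rw [← isCompact_univ_iff, hind.isCompact_iff, Set.image_univ]
  refine IsCompact.of_isClosed_subset
    (isCompact_univ_pi fun a : A => isCompact_Icc (a := -r (-a)) (b := r a)) ?_ ?_
  · have : Set.range (fun (σ : State A) (a : A) => σ a) =
        {f : A → ℝ | (∀ a b, f (a + b) = f a + f b) ∧ (∀ (c : ℝ) a, f (c • a) = c * f a) ∧
          (∀ a b, a ≤ b → f a ≤ f b) ∧ f 1 = 1} := by
      ext f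
      constructor
      · rintro ⟨σ, rfl⟩
        exact ⟨σ.map_add', hsmul σ, fun a b h => hmono σ h, hone σ⟩
      · rintro ⟨h1, h2, h3, h4⟩
        exact ⟨⟨⟨⟨⟨f, h1⟩, h2⟩, fun a b h => h3 a b h⟩, h4⟩, rfl⟩
    rw [this]
    simp only [Set.ofPred_and, Set.ofPred_forall]
    refine ((isClosed_iInter fun a => isClosed_iInter fun b => ?_).inter
      ((isClosed_iInter fun c => isClosed_iInter fun a => ?_).inter
      ((isClosed_iInter fun a => isClosed_iInter fun b => isClosed_iInter fun _ => ?_).inter ?_)))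
    · exact isClosed_eq (by fun_prop) (by fun_prop)
    · exact isClosed_eq (by fun_prop) (by fun_prop)
    · exact isClosed_le (by fun_prop) (by fun_prop)
    · exact isClosed_eq (by fun_prop) (by fun_prop)
  · rintro _ ⟨σ, rfl⟩ a -
    have := hle σ (-a)
    rw [hneg] at this
    exact ⟨by linarith, hle σ a⟩

/-! ### Lip-norms and quantum metric spaces -/

/-- `d_L(σ, τ) = sup {|σ(a) - τ(a)| : L(a) ≤ 1}`, as an extended real number. -/
def lipEDist (L : A → ℝ≥0∞) (σ τ : State A) : ℝ≥0∞ :=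
  ⨆ (a : A) (_ : L a ≤ 1), ENNReal.ofReal |σ a - τ a|

/-- `L` is a Lip-norm: a (finite) seminorm that vanishes exactly on the multiples of the unit and
such that `d_L` is a metric on the states which induces the weak-* topology. -/
structure IsLipNorm (L : A → ℝ≥0∞) : Prop where
  ne_top : ∀ a, L a ≠ ∞
  add_le : ∀ a b, L (a + b) ≤ L a + L b
  smul_eq : ∀ (r : ℝ) (a : A), L (r • a) = ENNReal.ofReal |r| * L a
  eq_zero_iff : ∀ a, L a = 0 ↔ ∃ r : ℝ, a = r • (1 : A)
  metrizes : ∃ m : MetricSpace (State A),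
    (∀ σ τ : State A, m.edist σ τ = lipEDist L σ τ) ∧
      m.toUniformSpace.toTopologicalSpace = State.instTopologicalSpace

/-- The pair `(A, L)` is a quantum metric space. -/
structure IsQuantumMetricSpace (L : A → ℝ≥0∞) : Prop where
  orderUnitSpace : OrderUnitSpace A
  isLipNorm : IsLipNorm L

/-- The metric space `S(A, L) = (S(A), d_L)`. -/
def StateSpace {L : A → ℝ≥0∞} (_ : IsQuantumMetricSpace L) : Type _ := State A

instance {L : A → ℝ≥0∞} (h : IsQuantumMetricSpace L) : MetricSpace (StateSpace h) :=
  h.isLipNorm.metrizes.choose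

instance {L : A → ℝ≥0∞} (h : IsQuantumMetricSpace L) : CompactSpace (StateSpace h) := by
  have := h.orderUnitSpace
  have hc : CompactSpace (State A) := State.compactSpace
  have ht := h.isLipNorm.metrizes.choose_spec.2
  rw [← ht] at hc
  exact hc

instance {L : A → ℝ≥0∞} (h : IsQuantumMetricSpace L) [hne : Nonempty (State A)] :
    Nonempty (StateSpace h) := hne

end States

/-- Morphisms of quantum metric spaces: order-unit morphisms that do not increase the Lip-norm. -/
def OrderUnitHom.IsLipMorphism {A B : Type*} [AddCommGroup A] [PartialOrder A] [Module ℝ A] [One A]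
    [AddCommGroup B] [PartialOrder B] [Module ℝ B] [One B] (φ : OrderUnitHom A B)
    (LA : A → ℝ≥0∞) (LB : B → ℝ≥0∞) : Prop :=
  ∀ a, LB (φ a) ≤ LA a

/-! ### The unitary dual of a topological group -/

section Dual

/-- A (topologically) irreducible, strongly continuous unitary representation of `G` on a complex
Hilbert space. -/
structure UnitaryIrrep (G : Type u) [Group G] [TopologicalSpace G] : Type (u + 1) where
  E : Type u
  [instNormedAddCommGroup : NormedAddCommGroup E]
  [instInnerProductSpace : InnerProductSpace ℂ E]
  [instCompleteSpace : CompleteSpace E]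
  rep : G →* unitary (E →L[ℂ] E)
  continuous_rep : ∀ v : E, Continuous fun g => (rep g : E →L[ℂ] E) v
  nontrivial : Nontrivial E
  irreducible : ∀ W : Submodule ℂ E, IsClosed (W : Set E) →
    (∀ g, ∀ v ∈ W, (rep g : E →L[ℂ] E) v ∈ W) → W = ⊥ ∨ W = ⊤

attribute [instance] UnitaryIrrep.instNormedAddCommGroup UnitaryIrrep.instInnerProductSpace
  UnitaryIrrep.instCompleteSpace

variable (G : Type u) [Group G] [TopologicalSpace G]

/-- Unitary equivalence of irreducible unitary representations. -/
instance UnitaryIrrep.instSetoid : Setoid (UnitaryIrrep G) where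
  r π π' := ∃ e : π.E ≃ₗᵢ[ℂ] π'.E, ∀ (g : G) (v : π.E),
    e ((π.rep g : π.E →L[ℂ] π.E) v) = (π'.rep g : π'.E →L[ℂ] π'.E) (e v)
  iseqv :=
    { refl := fun π => ⟨LinearIsometryEquiv.refl ℂ π.E, fun _ _ => rfl⟩
      symm := fun {π π'} ⟨e, he⟩ => ⟨e.symm, fun g v => by
        apply e.injective
        rw [he]
        simp⟩
      trans := fun {π π' π''} ⟨e, he⟩ ⟨e', he'⟩ => ⟨e.trans e', fun g v => by
        simp [he, he']⟩ }

/-- The unitary dual `Ĝ`: equivalence classes of irreducible unitary representations. -/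
def UnitaryDual : Type (u + 1) := Quotient (UnitaryIrrep.instSetoid G)

end Dual

/-! ### Compact groups with a bi-invariant metric -/

section MetricGroup

variable {G : Type u} [Group G] [MetricSpace G] [IsIsometricSMul G G] [IsIsometricSMul Gᵐᵒᵖ G]

instance metricGroup_isTopologicalGroup : IsTopologicalGroup G where
  continuous_mul := by
    have h : LipschitzWith 2 (fun p : G × G => p.1 * p.2) := by
      refine LipschitzWith.of_dist_le_mul fun p q => ?_
      calc dist (p.1 * p.2) (q.1 * q.2)
          ≤ dist (p.1 * p.2) (q.1 * p.2) + dist (q.1 * p.2) (q.1 * q.2) := dist_triangle _ _ _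
        _ = dist p.1 q.1 + dist p.2 q.2 := by rw [dist_mul_right, dist_mul_left]
        _ ≤ dist p q + dist p q := add_le_add (le_max_left _ _) (le_max_right _ _)
        _ = ((2 : ℝ≥0) : ℝ) * dist p q := by push_cast; ring
    exact h.continuous
  continuous_inv :=
    (Isometry.of_dist_eq fun x y : G => dist_inv_inv x y).continuous

variable (G) in
/-- The algebra of real-valued Lipschitz functions on `G`, as a subspace of `C(G, ℝ)`. -/
def LipAlg : Submodule ℝ C(G, ℝ) where
  carrier := {f | ∃ K : ℝ≥0, LipschitzWith K f}
  zero_mem' := ⟨0, LipschitzWith.const 0⟩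
  add_mem' := fun ⟨K, hK⟩ ⟨K', hK'⟩ => ⟨K + K', hK.add hK'⟩
  smul_mem' := fun c _ ⟨K, hK⟩ => ⟨‖c‖₊ * K, (lipschitzWith_smul c).comp hK⟩

/-- The order unit of `LipAlg G` is the constant function `1`. -/
instance LipAlg.instOne : One (LipAlg G) := ⟨⟨1, 0, LipschitzWith.const 1⟩⟩

/-- The lowest Lipschitz constant of a Lipschitz function. -/
def lipNorm (f : LipAlg G) : ℝ≥0∞ :=
  ⨅ (K : ℝ≥0) (_ : LipschitzWith K (f : C(G, ℝ))), (K : ℝ≥0∞)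

variable [CompactSpace G] [MeasurableSpace G] [BorelSpace G]

variable (G) in
/-- The normalized Haar measure. -/
abbrev haarProb : Measure G := Measure.haarMeasure (⊤ : TopologicalSpace.PositiveCompacts G)

instance haarProb_isProbabilityMeasure : IsProbabilityMeasure (haarProb G) :=
  ⟨Measure.haarMeasure_self⟩

instance haarProb_isMulRightInvariant : (haarProb G).IsMulRightInvariant where
  map_mul_right_eq_self g := by
    have : IsProbabilityMeasure ((haarProb G).map (· * g)) :=
      Measure.isProbabilityMeasure_map (by fun_prop)
    exact Measure.isHaarMeasure_eq_of_isProbabilityMeasure _ _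

variable (G) in
/-- The Hilbert space `L²(G)`. -/
abbrev L2 : Type u := Lp ℂ 2 (haarProb G)

/-- The left regular representation, `(U_g ψ)(x) = ψ(g⁻¹ x)`. -/
def leftReg (g : G) : L2 G →L[ℂ] L2 G :=
  (Lp.compMeasurePreservingₗᵢ ℂ (fun x : G => g⁻¹ * x)
    (measurePreserving_mul_left (haarProb G) g⁻¹)).toContinuousLinearMap

/-- The right regular representation, `(V_g ψ)(x) = ψ(x g)`. -/
def rightReg (g : G) : L2 G →L[ℂ] L2 G :=
  (Lp.compMeasurePreservingₗᵢ ℂ (fun x : G => x * g)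
    (measurePreserving_mul_right (haarProb G) g)).toContinuousLinearMap

/-- `λ_g(T) = U_g T U_g^*`. -/
def lamAct (g : G) (T : L2 G →L[ℂ] L2 G) : L2 G →L[ℂ] L2 G :=
  leftReg g ∘L T ∘L ContinuousLinearMap.adjoint (leftReg g)

/-- `ρ_g(T) = V_g T V_g^*`. -/
def rhoAct (g : G) (T : L2 G →L[ℂ] L2 G) : L2 G →L[ℂ] L2 G :=
  rightReg g ∘L T ∘L ContinuousLinearMap.adjoint (rightReg g)

/-- `‖T‖_λ`, possibly infinite. -/
def lamNorm (T : L2 G →L[ℂ] L2 G) : ℝ≥0∞ :=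
  ⨆ (x : G) (y : G) (_ : x ≠ y), ENNReal.ofReal (‖lamAct x T - lamAct y T‖ / dist x y)

/-- `‖T‖_ρ`, possibly infinite. -/
def rhoNorm (T : L2 G →L[ℂ] L2 G) : ℝ≥0∞ :=
  ⨆ (x : G) (y : G) (_ : x ≠ y), ENNReal.ofReal (‖rhoAct x T - rhoAct y T‖ / dist x y)

/-- The operator of pointwise multiplication by the real-valued continuous function `f`. -/
def mulOp : C(G, ℝ) →ₗ[ℝ] (L2 G →L[ℂ] L2 G) where
  toFun f := (ContinuousLinearMap.mul ℂ ℂ).holderL (haarProb G) ∞ 2 2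
    (ContinuousMap.toLp ∞ (haarProb G) ℂ ((⟨Complex.ofReal, Complex.continuous_ofReal⟩ :
      C(ℝ, ℂ)).comp f))
  map_add' f f' := by
    rw [← map_add, ← map_add]
    congr 2
    ext x
    simp
  map_smul' c f := by
    have h : (⟨Complex.ofReal, Complex.continuous_ofReal⟩ : C(ℝ, ℂ)).comp (c • f) =
        (c : ℂ) • (⟨Complex.ofReal, Complex.continuous_ofReal⟩ : C(ℝ, ℂ)).comp f := by
      ext x
      simp
    rw [h, map_smul, map_smul]
    ext1 ψ
    exact Complex.coe_smul c _

/-! ### Spectral truncations -/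

/-- The matrix coefficient `x ↦ ⟪ξ, π(x⁻¹) η⟫`. The linear span of these functions, for `π` fixed,
is the copy of `E_π ⊗ E_π^*` in `L²(G)`, where `U` acts on `η ∈ E_π` and `V` on
`⟪ξ, ·⟫ ∈ E_π^*`. -/
def matrixCoeff (π : UnitaryIrrep G) (ξ η : π.E) : C(G, ℂ) where
  toFun x := inner ℂ ξ ((π.rep x⁻¹ : π.E →L[ℂ] π.E) η)
  continuous_toFun := continuous_const.inner ((π.continuous_rep η).comp continuous_inv)

/-- `L²(G)_Λ`, the (closed) span of the `E_ν ⊗ E_ν^*` with `ν ∈ Λ`. -/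
def truncSpace (Λ : Finset (UnitaryDual G)) : Submodule ℂ (L2 G) :=
  (Submodule.span ℂ {ψ | ∃ (π : UnitaryIrrep G) (ξ η : π.E),
    (Quotient.mk _ π : UnitaryDual G) ∈ Λ ∧
      ψ = ContinuousMap.toLp 2 (haarProb G) ℂ (matrixCoeff π ξ η)}).topologicalClosure

instance (Λ : Finset (UnitaryDual G)) : CompleteSpace (truncSpace Λ) :=
  (Submodule.isClosed_topologicalClosure _).completeSpace_coe

/-- The orthogonal projection `P_Λ` of `L²(G)` onto `L²(G)_Λ`. -/
def truncProj (Λ : Finset (UnitaryDual G)) : L2 G →L[ℂ] L2 G := (truncSpace Λ).starProjection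

/-- The compression `T ↦ P_Λ T P_Λ`. -/
def compress (Λ : Finset (UnitaryDual G)) : (L2 G →L[ℂ] L2 G) →ₗ[ℝ] (L2 G →L[ℂ] L2 G) where
  toFun T := truncProj Λ ∘L T ∘L truncProj Λ
  map_add' S T := by ext; simp
  map_smul' c T := by
    ext1 ψ
    simp

/-- `A_Λ = P_Λ A P_Λ`, with the order inherited from the bounded operators on `L²(G)`. -/
def TruncAlg (Λ : Finset (UnitaryDual G)) : Submodule ℝ (L2 G →L[ℂ] L2 G) :=
  (LipAlg G).map (compress Λ ∘ₗ mulOp)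

/-- The map `τ_Λ : A → A_Λ`, `f ↦ P_Λ f P_Λ`. -/
def trunc (Λ : Finset (UnitaryDual G)) (f : LipAlg G) : TruncAlg Λ :=
  ⟨compress Λ (mulOp (f : C(G, ℝ))), Submodule.mem_map_of_mem f.2⟩

theorem mulOp_one : mulOp (1 : C(G, ℝ)) = ContinuousLinearMap.id ℂ (L2 G) := by
  ext1 ψ
  apply Lp.ext
  refine (ContinuousLinearMap.coeFn_holder _ _ _).trans ?_
  filter_upwards [ContinuousMap.coeFn_toLp (p := ∞) (𝕜 := ℂ) (haarProb G)
    ((⟨Complex.ofReal, Complex.continuous_ofReal⟩ : C(ℝ, ℂ)).comp (1 : C(G, ℝ)))] with x hx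
  rw [hx]
  simp

/-- The order unit of `A_Λ` is `P_Λ`, the identity of `L²(G)_Λ`. -/
instance TruncAlg.instOne (Λ : Finset (UnitaryDual G)) : One (TruncAlg Λ) :=
  ⟨⟨truncProj Λ, 1, (1 : LipAlg G).2, by
    change truncProj Λ ∘L mulOp (1 : C(G, ℝ)) ∘L truncProj Λ = truncProj Λ
    rw [mulOp_one, ContinuousLinearMap.id_comp]
    exact (truncSpace Λ).isIdempotentElem_starProjection⟩⟩

/-- `L_Λ`, the restriction of `‖·‖_{λ,ρ} = max (‖·‖_λ, ‖·‖_ρ)` to `A_Λ`. -/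
def truncLipNorm (Λ : Finset (UnitaryDual G)) (T : TruncAlg Λ) : ℝ≥0∞ :=
  max (lamNorm (T : L2 G →L[ℂ] L2 G)) (rhoNorm (T : L2 G →L[ℂ] L2 G))

/-! ### The action `ρ` on `A_Λ` -/

theorem coeFn_rightReg (g : G) (ψ : L2 G) :
    rightReg g ψ =ᵐ[haarProb G] fun x => ψ (x * g) :=
  Lp.coeFn_compMeasurePreserving ψ (measurePreserving_mul_right (haarProb G) g)

theorem rightReg_mul_inv (g : G) : rightReg g ∘L rightReg g⁻¹ = ContinuousLinearMap.id ℂ (L2 G) := by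
  ext1 ψ
  apply Lp.ext
  refine (coeFn_rightReg g (rightReg g⁻¹ ψ)).trans ?_
  filter_upwards [(measurePreserving_mul_right (haarProb G) g).quasiMeasurePreserving.ae
    (coeFn_rightReg g⁻¹ ψ)] with x hx
  simpa using hx

theorem adjoint_rightReg (g : G) : ContinuousLinearMap.adjoint (rightReg g) = rightReg g⁻¹ := by
  have h : ContinuousLinearMap.adjoint (rightReg g) ∘L rightReg g =
      ContinuousLinearMap.id ℂ (L2 G) :=
    (ContinuousLinearMap.norm_map_iff_adjoint_comp_self _).1 fun ψ =>
      (Lp.compMeasurePreservingₗᵢ ℂ (fun x : G => x * g)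
        (measurePreserving_mul_right (haarProb G) g)).norm_map ψ
  calc ContinuousLinearMap.adjoint (rightReg g)
      = ContinuousLinearMap.adjoint (rightReg g) ∘L (rightReg g ∘L rightReg g⁻¹) := by
        rw [rightReg_mul_inv, ContinuousLinearMap.comp_id]
    _ = rightReg g⁻¹ := by
        rw [← ContinuousLinearMap.comp_assoc, h, ContinuousLinearMap.id_comp]

theorem rightReg_mem_truncSpace (Λ : Finset (UnitaryDual G)) (g : G) {ψ : L2 G}
    (hψ : ψ ∈ truncSpace Λ) : rightReg g ψ ∈ truncSpace Λ := by
  refine map_mem_closure (rightReg g).continuous hψ fun φ hφ => ?_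
  refine (Submodule.span_le (p := (Submodule.span ℂ _).comap (rightReg g).toLinearMap)).2 ?_ hφ
  rintro _ ⟨π, ξ, η, hπ, rfl⟩
  refine Submodule.subset_span ⟨π, (π.rep g : π.E →L[ℂ] π.E) ξ, η, hπ, ?_⟩
  apply Lp.ext
  refine (coeFn_rightReg g _).trans ?_
  filter_upwards [(measurePreserving_mul_right (haarProb G) g).quasiMeasurePreserving.ae
    (ContinuousMap.coeFn_toLp (p := 2) (𝕜 := ℂ) (haarProb G) (matrixCoeff π ξ η)),
    ContinuousMap.coeFn_toLp (p := 2) (𝕜 := ℂ) (haarProb G)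
      (matrixCoeff π ((π.rep g : π.E →L[ℂ] π.E) ξ) η)] with x hx hx'
  rw [hx, hx']
  have hu : ContinuousLinearMap.adjoint (π.rep g : π.E →L[ℂ] π.E) = (π.rep g⁻¹ : π.E →L[ℂ] π.E) := by
    rw [map_inv]
    rfl
  simp only [matrixCoeff, ContinuousMap.coe_mk]
  rw [← ContinuousLinearMap.adjoint_inner_right, hu, mul_inv_rev, map_mul]
  rfl

theorem rightReg_comp_truncProj (Λ : Finset (UnitaryDual G)) (g : G) :
    rightReg g ∘L truncProj Λ = truncProj Λ ∘L rightReg g := by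
  ext1 ψ
  refine (Submodule.eq_starProjection_of_mem_of_inner_eq_zero ?_ fun w hw => ?_).symm
  · exact rightReg_mem_truncSpace Λ g (Submodule.starProjection_apply_mem _ ψ)
  · change inner ℂ (rightReg g ψ - rightReg g (truncProj Λ ψ)) w = 0
    rw [← map_sub, ← ContinuousLinearMap.adjoint_inner_right, adjoint_rightReg]
    exact Submodule.starProjection_inner_eq_zero ψ _ (rightReg_mem_truncSpace Λ g⁻¹ hw)

theorem rightReg_comp_mulOp (g : G) (f : C(G, ℝ)) :
    rightReg g ∘L mulOp f = mulOp (f.comp ⟨fun x => x * g, by fun_prop⟩) ∘L rightReg g := by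
  ext1 ψ
  apply Lp.ext
  refine (coeFn_rightReg g _).trans ?_
  refine Filter.EventuallyEq.trans ?_ (ContinuousLinearMap.coeFn_holder _ _ _).symm
  have hq := (measurePreserving_mul_right (haarProb G) g).quasiMeasurePreserving
  filter_upwards [hq.ae (ContinuousLinearMap.coeFn_holder (r := 2) (ContinuousLinearMap.mul ℂ ℂ)
      (ContinuousMap.toLp ∞ (haarProb G) ℂ
        ((⟨Complex.ofReal, Complex.continuous_ofReal⟩ : C(ℝ, ℂ)).comp f)) ψ),
    hq.ae (ContinuousMap.coeFn_toLp (p := ∞) (𝕜 := ℂ) (haarProb G)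
      ((⟨Complex.ofReal, Complex.continuous_ofReal⟩ : C(ℝ, ℂ)).comp f)),
    ContinuousMap.coeFn_toLp (p := ∞) (𝕜 := ℂ) (haarProb G)
      ((⟨Complex.ofReal, Complex.continuous_ofReal⟩ : C(ℝ, ℂ)).comp
        (f.comp ⟨fun x => x * g, by fun_prop⟩)),
    coeFn_rightReg g ψ] with x h1 h2 h3 h4
  rw [h3]
  refine h1.trans ?_
  rw [h2]
  exact congrArg _ h4.symm

theorem rhoAct_mem_truncAlg (Λ : Finset (UnitaryDual G)) (g : G) {T : L2 G →L[ℂ] L2 G}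
    (hT : T ∈ TruncAlg Λ) : rhoAct g T ∈ TruncAlg Λ := by
  obtain ⟨f, ⟨K, hK⟩, rfl⟩ := hT
  refine ⟨f.comp ⟨fun x => x * g, by fun_prop⟩, ⟨K * 1, hK.comp ?_⟩, ?_⟩
  · exact (Isometry.of_dist_eq fun x y : G => dist_mul_right x y g).lipschitz
  · change truncProj Λ ∘L mulOp _ ∘L truncProj Λ =
      rightReg g ∘L (truncProj Λ ∘L mulOp f ∘L truncProj Λ) ∘L
        ContinuousLinearMap.adjoint (rightReg g)
    rw [adjoint_rightReg]
    have h1 := rightReg_comp_truncProj Λ g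
    have h2 := rightReg_comp_mulOp g f
    have h3 := rightReg_mul_inv g
    ext1 ψ
    simp only [DFunLike.ext_iff, ContinuousLinearMap.comp_apply] at h1 h2 h3 ⊢
    rw [h1, h2, h1, h3]
    rfl

/-- The restriction of `ρ_g` to `A_Λ`. -/
def truncRho (Λ : Finset (UnitaryDual G)) (g : G) (T : TruncAlg Λ) : TruncAlg Λ :=
  ⟨rhoAct g T, rhoAct_mem_truncAlg Λ g T.2⟩

/-- The state `σ` on `A_Λ` is the lift of the measure `μ`: `σ ∘ τ_Λ = μ` on the Lipschitz
functions. There is at most one such state, since `τ_Λ : A → A_Λ` is onto. -/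
def IsLift (Λ : Finset (UnitaryDual G)) (μ : Measure G) (σ : State (TruncAlg Λ)) : Prop :=
  ∀ f : LipAlg G, σ (trunc Λ f) = ∫ x, (f : C(G, ℝ)) x ∂μ

end MetricGroup

end

/-!
Put `υ T g = μΛ (ρ_g(T))`. Both `τ_Λ` and `υ` are morphisms of quantum metric spaces, and they are
approximately inverse to each other: `υ (τ_Λ f) = ∫ f(x ·) dμ(x)` and
`τ_Λ (υ T) = ∫ λ_{x⁻¹}(T) dμ(x)`, so each composite moves the elements of the Lip unit ball by at
most the mean distance `∫ d(e, x) dμ(x)`. The graphs of the induced contractions of the state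
spaces are isometric copies of these spaces in their product with the maximum metric, and lie within
that Hausdorff distance of each other.

That the seminorms are Lip-norms follows from Rieffel's criterion, that the Lip unit ball be totally
bounded modulo scalars. For Lipschitz functions this is the Arzelà–Ascoli theorem. The space `A_Λ`
is finite-dimensional, since irreducible unitary representations of compact groups are, and the
average of `ρ_g(T)` over the Haar measure is a scalar whose distance to `T` is at most `diam G`
times `L_Λ(T)`.
-/

noncomputable section

section OrderUnitSpaces

variable {A B C : Type*} [AddCommGroup A] [PartialOrder A] [Module ℝ A] [One A]
  [AddCommGroup B] [PartialOrder B] [Module ℝ B] [One B]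
  [AddCommGroup C] [PartialOrder C] [Module ℝ C] [One C]

namespace OrderUnitHom

instance : LinearMapClass (OrderUnitHom A B) ℝ A B where
  map_add φ := φ.map_add'
  map_smulₛₗ φ := φ.map_smul'

instance : OrderHomClass (OrderUnitHom A B) A B where
  map_rel φ _ _ h := φ.monotone' h

instance : OneHomClass (OrderUnitHom A B) A B where
  map_one φ := φ.map_one'

/-- The composite of two order-unit morphisms. -/
def comp (ψ : OrderUnitHom B C) (φ : OrderUnitHom A B) : OrderUnitHom A C where
  toPositiveLinearMap := ψ.toPositiveLinearMap.comp φ.toPositiveLinearMap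
  map_one' := (congrArg ψ (map_one φ)).trans (map_one ψ)

end OrderUnitHom

/-- The order interval `-r • 1 ≤ a ≤ r • 1`. -/
def OrderBounded (a : A) (r : ℝ) : Prop := a ≤ r • (1 : A) ∧ -a ≤ r • (1 : A)

theorem State.map_smul_one (σ : State A) (r : ℝ) : σ (r • (1 : A)) = r := by
  rw [map_smul, map_one, smul_eq_mul, mul_one]

theorem State.abs_le (σ : State A) {a : A} {r : ℝ} (h : OrderBounded a r) : |σ a| ≤ r := by
  refine abs_le'.2 ⟨?_, ?_⟩
  · simpa only [σ.map_smul_one] using OrderHomClass.mono σ h.1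
  · simpa only [σ.map_smul_one, map_neg] using OrderHomClass.mono σ h.2

theorem State.continuous_eval (a : A) : Continuous fun σ : State A => σ a :=
  (continuous_apply a).comp continuous_induced_dom

theorem lipEDist_self (L : A → ℝ≥0∞) (σ : State A) : lipEDist L σ σ = 0 := by
  simp [lipEDist]

theorem lipEDist_comm (L : A → ℝ≥0∞) (σ τ : State A) : lipEDist L σ τ = lipEDist L τ σ := by
  simp only [lipEDist, abs_sub_comm]

theorem ofReal_abs_sub_le_lipEDist {L : A → ℝ≥0∞} {a : A} (ha : L a ≤ 1) (σ τ : State A) :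
    ENNReal.ofReal |σ a - τ a| ≤ lipEDist L σ τ :=
  le_iSup₂ (f := fun b (_ : L b ≤ 1) => ENNReal.ofReal |σ b - τ b|) a ha

theorem lipEDist_triangle (L : A → ℝ≥0∞) (σ τ υ : State A) :
    lipEDist L σ υ ≤ lipEDist L σ τ + lipEDist L τ υ :=
  iSup₂_le fun a ha =>
    calc ENNReal.ofReal |σ a - υ a|
        ≤ ENNReal.ofReal (|σ a - τ a| + |τ a - υ a|) :=
          ENNReal.ofReal_le_ofReal (abs_sub_le _ _ _)
      _ = ENNReal.ofReal |σ a - τ a| + ENNReal.ofReal |τ a - υ a| :=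
          ENNReal.ofReal_add (abs_nonneg _) (abs_nonneg _)
      _ ≤ lipEDist L σ τ + lipEDist L τ υ :=
          add_le_add (ofReal_abs_sub_le_lipEDist ha _ _) (ofReal_abs_sub_le_lipEDist ha _ _)

/-- A Lipschitz seminorm in the sense of Rieffel: a finite seminorm vanishing exactly on the
multiples of the unit. These are the clauses of `IsLipNorm` that do not mention states. -/
structure IsLipschitzSeminorm (L : A → ℝ≥0∞) : Prop where
  ne_top : ∀ a, L a ≠ ∞
  add_le : ∀ a b, L (a + b) ≤ L a + L b
  smul_eq : ∀ (r : ℝ) (a : A), L (r • a) = ENNReal.ofReal |r| * L a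
  eq_zero_iff : ∀ a, L a = 0 ↔ ∃ r : ℝ, a = r • (1 : A)

/-- The unit ball of `L` is totally bounded modulo the multiples of the order unit. -/
def LipBallTotallyBounded (L : A → ℝ≥0∞) : Prop :=
  ∀ ε : ℝ, 0 < ε → ∃ F : Set A, F.Finite ∧
    ∀ a, L a ≤ 1 → ∃ b ∈ F, ∃ r : ℝ, OrderBounded (a - b - r • (1 : A)) ε

theorem lipEDist_le_of_net {L : A → ℝ≥0∞} {F : Set A} {ε δ : ℝ}
    (hF : ∀ a, L a ≤ 1 → ∃ b ∈ F, ∃ r : ℝ, OrderBounded (a - b - r • (1 : A)) ε)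
    {σ τ : State A} (h : ∀ b ∈ F, |σ b - τ b| ≤ δ) :
    lipEDist L σ τ ≤ ENNReal.ofReal (δ + 2 * ε) := by
  refine iSup₂_le fun a ha => ENNReal.ofReal_le_ofReal ?_
  obtain ⟨b, hb, r, hr⟩ := hF a ha
  have hσ := σ.abs_le hr
  have hτ := τ.abs_le hr
  simp only [map_sub, State.map_smul_one] at hσ hτ
  calc |σ a - τ a| = |(σ b - τ b) + (σ a - σ b - r) - (τ a - τ b - r)| := by congr 1; ring
    _ ≤ |σ b - τ b| + |σ a - σ b - r| + |τ a - τ b - r| :=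
        (abs_sub _ _).trans (add_le_add_left (abs_add_le _ _) _)
    _ ≤ δ + 2 * ε := by linarith [h b hb]

theorem LipBallTotallyBounded.lipEDist_ne_top {L : A → ℝ≥0∞} (hL : LipBallTotallyBounded L)
    (σ τ : State A) : lipEDist L σ τ ≠ ∞ := by
  obtain ⟨F, hFfin, hF⟩ := hL 1 one_pos
  obtain ⟨δ, hδ⟩ := (hFfin.image fun b => |σ b - τ b|).bddAbove
  exact ne_top_of_le_ne_top ENNReal.ofReal_ne_top
    (lipEDist_le_of_net hF fun b hb => hδ (Set.mem_image_of_mem _ hb))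

theorem LipBallTotallyBounded.eventually_lipEDist_lt {L : A → ℝ≥0∞}
    (hL : LipBallTotallyBounded L) (σ : State A) {ε : ℝ≥0∞} (hε : 0 < ε) :
    ∀ᶠ τ in nhds σ, lipEDist L τ σ < ε := by
  obtain ⟨q, -, hq⟩ := ENNReal.lt_iff_exists_real_btwn.1 hε
  have hq0 : 0 < q := ENNReal.ofReal_pos.1 hq.1
  obtain ⟨F, hFfin, hF⟩ := hL (q / 3) (by positivity)
  have hτ : ∀ᶠ τ in nhds σ, ∀ b ∈ F, |τ b - σ b| ≤ q / 3 :=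
    (Filter.eventually_all_finite hFfin).2 fun b _ => (State.continuous_eval b).continuousAt
      (Metric.closedBall_mem_nhds (σ b) (by positivity))
  filter_upwards [hτ] with τ hτ
  calc lipEDist L τ σ ≤ ENNReal.ofReal (q / 3 + 2 * (q / 3)) := lipEDist_le_of_net hF hτ
    _ = ENNReal.ofReal q := by ring_nf
    _ < ε := hq.2

namespace IsLipschitzSeminorm

variable {L : A → ℝ≥0∞}

theorem ofReal_abs_sub_le_mul_lipEDist (hL : IsLipschitzSeminorm L) (σ τ : State A) (a : A) :
    ENNReal.ofReal |σ a - τ a| ≤ L a * lipEDist L σ τ := by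
  by_cases h0 : L a = 0
  · obtain ⟨r, rfl⟩ := (hL.eq_zero_iff a).1 h0
    simp
  · have hc : 0 < (L a).toReal := ENNReal.toReal_pos h0 (hL.ne_top a)
    have hinv : ENNReal.ofReal |(L a).toReal⁻¹| = (L a)⁻¹ := by
      rw [abs_of_pos (inv_pos.2 hc), ENNReal.ofReal_inv_of_pos hc,
        ENNReal.ofReal_toReal (hL.ne_top a)]
    have hunit : L ((L a).toReal⁻¹ • a) ≤ 1 := by
      rw [hL.smul_eq, hinv, ENNReal.inv_mul_cancel h0 (hL.ne_top a)]
    have h := ofReal_abs_sub_le_lipEDist hunit σ τ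
    rw [map_smul, map_smul, ← smul_sub, smul_eq_mul, abs_mul, ENNReal.ofReal_mul (abs_nonneg _),
      hinv] at h
    exact (ENNReal.inv_mul_le_iff h0 (hL.ne_top a)).1 h

theorem eq_of_lipEDist_eq_zero (hL : IsLipschitzSeminorm L) {σ τ : State A}
    (h : lipEDist L σ τ = 0) : σ = τ := by
  refine DFunLike.ext _ _ fun a => ?_
  have ha := hL.ofReal_abs_sub_le_mul_lipEDist σ τ a
  rw [h, mul_zero, nonpos_iff_eq_zero, ENNReal.ofReal_eq_zero, abs_nonpos_iff] at ha
  exact sub_eq_zero.1 ha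

/-- The states with the metric `d_L`, before it is known to be finite. -/
abbrev emetricSpace (hL : IsLipschitzSeminorm L) : EMetricSpace (State A) where
  edist := lipEDist L
  edist_self := lipEDist_self L
  edist_comm := lipEDist_comm L
  edist_triangle := lipEDist_triangle L
  eq_of_edist_eq_zero := hL.eq_of_lipEDist_eq_zero

theorem topology_le_weakStar (hL : IsLipschitzSeminorm L) :
    hL.emetricSpace.toUniformSpace.toTopologicalSpace ≤ State.instTopologicalSpace := by
  let e := hL.emetricSpace
  refine continuous_iff_le_induced.1 (@continuous_pi _ _ _ e.toUniformSpace.toTopologicalSpace _ _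
    fun a => @LipschitzWith.continuous _ _ e.toPseudoEMetricSpace _ (L a).toNNReal _ fun σ τ => ?_)
  rw [ENNReal.coe_toNNReal (hL.ne_top a), edist_dist, Real.dist_eq]
  exact hL.ofReal_abs_sub_le_mul_lipEDist σ τ a

theorem weakStar_le_topology (hL : IsLipschitzSeminorm L) (htb : LipBallTotallyBounded L) :
    State.instTopologicalSpace ≤ hL.emetricSpace.toUniformSpace.toTopologicalSpace :=
  le_of_nhds_le_nhds fun σ =>
    (@Metric.nhds_basis_eball _ hL.emetricSpace.toPseudoEMetricSpace σ).ge_iff.2 fun _ hε =>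
      htb.eventually_lipEDist_lt σ hε

/-- Rieffel's criterion. -/
theorem isLipNorm (hL : IsLipschitzSeminorm L) (htb : LipBallTotallyBounded L) : IsLipNorm L where
  ne_top := hL.ne_top
  add_le := hL.add_le
  smul_eq := hL.smul_eq
  eq_zero_iff := hL.eq_zero_iff
  metrizes := ⟨@EMetricSpace.toMetricSpace _ hL.emetricSpace htb.lipEDist_ne_top, fun _ _ => rfl,
    hL.topology_le_weakStar.antisymm (hL.weakStar_le_topology htb)⟩

end IsLipschitzSeminorm

namespace StateSpace

variable {LA : A → ℝ≥0∞} {LB : B → ℝ≥0∞}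

theorem edist_eq (hA : IsQuantumMetricSpace LA) (σ τ : StateSpace hA) :
    edist σ τ = lipEDist LA σ τ :=
  hA.isLipNorm.metrizes.choose_spec.1 σ τ

theorem dist_le_of_forall (hA : IsQuantumMetricSpace LA) {r : ℝ} (hr : 0 ≤ r) {σ τ : State A}
    (hστ : ∀ a, LA a ≤ 1 → |σ a - τ a| ≤ r) : dist (α := StateSpace hA) σ τ ≤ r :=
  (edist_le_ofReal hr).1 <| (edist_eq hA σ τ).le.trans <|
    iSup₂_le fun a ha => ENNReal.ofReal_le_ofReal (hστ a ha)

/-- The map of state spaces induced by an order-unit morphism. -/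
def pullback (hA : IsQuantumMetricSpace LA) (hB : IsQuantumMetricSpace LB)
    (φ : OrderUnitHom A B) : StateSpace hB → StateSpace hA :=
  fun σ => OrderUnitHom.comp σ φ

theorem lipschitzWith_pullback (hA : IsQuantumMetricSpace LA) (hB : IsQuantumMetricSpace LB)
    {φ : OrderUnitHom A B} (hφ : φ.IsLipMorphism LA LB) :
    LipschitzWith 1 (pullback hA hB φ) := fun σ τ => by
  rw [edist_eq, edist_eq, ENNReal.coe_one, one_mul]
  exact iSup₂_le fun a ha => ofReal_abs_sub_le_lipEDist ((hφ a).trans ha) σ τ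

theorem dist_pullback_pullback_le (hA : IsQuantumMetricSpace LA) (hB : IsQuantumMetricSpace LB)
    {φ : OrderUnitHom A B} {ψ : OrderUnitHom B A} {r : ℝ} (hr : 0 ≤ r)
    (h : ∀ a, LA a ≤ 1 → OrderBounded (ψ (φ a) - a) r) (σ : State A) :
    dist (α := StateSpace hA) (pullback hA hB φ (pullback hB hA ψ σ)) σ ≤ r :=
  dist_le_of_forall hA hr fun a ha =>
    (congrArg abs (map_sub σ (ψ (φ a)) a)).ge.trans (σ.abs_le (h a ha))

end StateSpace

end OrderUnitSpaces

theorem ghDist_le_of_contractions {X Y : Type*} [MetricSpace X] [CompactSpace X] [Nonempty X]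
    [MetricSpace Y] [CompactSpace Y] [Nonempty Y] {f : X → Y} {g : Y → X} {r : ℝ} (hr : 0 ≤ r)
    (hf : LipschitzWith 1 f) (hg : LipschitzWith 1 g) (hgf : ∀ x, dist (g (f x)) x ≤ r)
    (hfg : ∀ y, dist (f (g y)) y ≤ r) : GromovHausdorff.ghDist X Y ≤ r := by
  -- The graphs of contractions are isometric copies of `X` and `Y` inside `X × Y`.
  have hΦ : Isometry fun x => (x, f x) := Isometry.of_dist_eq fun x x' => by
    simpa [Prod.dist_eq] using hf.dist_le_mul x x'
  have hΨ : Isometry fun y => (g y, y) := Isometry.of_dist_eq fun y y' => by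
    simpa [Prod.dist_eq] using hg.dist_le_mul y y'
  refine (GromovHausdorff.ghDist_le_hausdorffDist hΦ hΨ).trans
    (Metric.hausdorffDist_le_of_mem_dist hr ?_ ?_)
  · rintro _ ⟨x, rfl⟩
    exact ⟨_, ⟨f x, rfl⟩, by simpa [Prod.dist_eq, hr, dist_comm x] using hgf x⟩
  · rintro _ ⟨y, rfl⟩
    exact ⟨_, ⟨g y, rfl⟩, by simpa [Prod.dist_eq, hr, dist_comm y] using hfg y⟩

theorem ghDist_stateSpace_le {A B : Type*} [AddCommGroup A] [PartialOrder A] [Module ℝ A] [One A]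
    [AddCommGroup B] [PartialOrder B] [Module ℝ B] [One B] {LA : A → ℝ≥0∞} {LB : B → ℝ≥0∞}
    (hA : IsQuantumMetricSpace LA) (hB : IsQuantumMetricSpace LB)
    [Nonempty (State A)] [Nonempty (State B)] {φ : OrderUnitHom A B} {ψ : OrderUnitHom B A}
    (hφ : φ.IsLipMorphism LA LB) (hψ : ψ.IsLipMorphism LB LA) {r : ℝ} (hr : 0 ≤ r)
    (hψφ : ∀ a, LA a ≤ 1 → OrderBounded (ψ (φ a) - a) r)
    (hφψ : ∀ b, LB b ≤ 1 → OrderBounded (φ (ψ b) - b) r) :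
    GromovHausdorff.ghDist (StateSpace hA) (StateSpace hB) ≤ r :=
  ghDist_le_of_contractions hr (StateSpace.lipschitzWith_pullback hB hA hψ)
    (StateSpace.lipschitzWith_pullback hA hB hφ)
    (StateSpace.dist_pullback_pullback_le hA hB hr hψφ)
    (StateSpace.dist_pullback_pullback_le hB hA hr hφψ)

section NormedOrderUnitSpaces

instance orderClosedTopology_continuousMap {X Y : Type*} [TopologicalSpace X] [TopologicalSpace Y]
    [PartialOrder Y] [OrderClosedTopology Y] : OrderClosedTopology C(X, Y) where
  isClosed_le' := by
    simp only [ContinuousMap.le_def, Set.ofPred_forall]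
    exact isClosed_iInter fun x => isClosed_le (by fun_prop) (by fun_prop)

theorem isOrderedModule_submodule {M : Type*} [AddCommGroup M] [PartialOrder M]
    [IsOrderedAddMonoid M] [Module ℝ M] [IsOrderedModule ℝ M] (S : Submodule ℝ M) :
    IsOrderedModule ℝ S :=
  IsOrderedModule.of_smul_nonneg fun r hr a ha =>
    show (0 : M) ≤ r • (a : M) from smul_nonneg hr ha

variable {A : Type*} [NormedAddCommGroup A] [PartialOrder A] [NormedSpace ℝ A] [One A]

theorem OrderUnitSpace.of_norm [IsOrderedAddMonoid A] [IsOrderedModule ℝ A] [ClosedIciTopology A]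
    (hnorm : ∀ (a : A) (r : ℝ), ‖a‖ ≤ r → OrderBounded a r) : OrderUnitSpace A where
  exists_le_smul_one a := ⟨‖a‖, (hnorm a _ le_rfl).1⟩
  le_zero_of_forall_le_smul_one a ha := by
    have hlim : Filter.Tendsto (fun r : ℝ => r • (1 : A)) (nhdsWithin 0 (Set.Ioi 0)) (nhds 0) := by
      have hcont : Continuous fun r : ℝ => r • (1 : A) := by fun_prop
      simpa using (hcont.tendsto 0).mono_left nhdsWithin_le_nhds
    exact ge_of_tendsto hlim (Filter.mem_of_superset self_mem_nhdsWithin ha)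

theorem IsLipschitzSeminorm.isQuantumMetricSpace [OrderUnitSpace A] {L : A → ℝ≥0∞}
    (hL : IsLipschitzSeminorm L) (hnorm : ∀ (a : A) (r : ℝ), ‖a‖ ≤ r → OrderBounded a r)
    {s : Set A} (hs : TotallyBounded s) (hLs : ∀ a, L a ≤ 1 → ∃ r : ℝ, a - r • (1 : A) ∈ s) :
    IsQuantumMetricSpace L := by
  refine ⟨inferInstance, hL.isLipNorm fun ε hε => ?_⟩
  obtain ⟨F, hFfin, hF⟩ := Metric.totallyBounded_iff.1 hs ε hε
  refine ⟨F, hFfin, fun a ha => ?_⟩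
  obtain ⟨r, hr⟩ := hLs a ha
  obtain ⟨b, hb, hab⟩ := Set.mem_iUnion₂.1 (hF hr)
  refine ⟨b, hb, r, hnorm _ _ ?_⟩
  rw [sub_right_comm]
  exact (mem_ball_iff_norm.1 hab).le

end NormedOrderUnitSpaces

section LipschitzConstants

variable {X E F : Type*} [MetricSpace X] [NormedAddCommGroup E] [NormedAddCommGroup F]

/-- The best Lipschitz constant of `f`, possibly infinite, in the form in which `lamNorm` and
`rhoNorm` are defined. -/
def lipSup (f : X → E) : ℝ≥0∞ :=
  ⨆ (x : X) (y : X) (_ : x ≠ y), ENNReal.ofReal (‖f x - f y‖ / dist x y)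

theorem lipSup_le_coe_iff {f : X → E} {K : ℝ≥0} : lipSup f ≤ K ↔ LipschitzWith K f := by
  simp only [lipSup, iSup_le_iff, lipschitzWith_iff_dist_le_mul, dist_eq_norm (f _)]
  refine forall₂_congr fun x y => ?_
  by_cases hxy : x = y
  · simp [hxy]
  · rw [ENNReal.ofReal_le_coe, div_le_iff₀ (dist_pos.2 hxy)]
    exact ⟨fun h => h hxy, fun h _ => h⟩

theorem lipSup_le_one_iff {f : X → E} : lipSup f ≤ 1 ↔ LipschitzWith 1 f :=
  lipSup_le_coe_iff (K := 1)

theorem lipschitzWith_lipSup {f : X → E} (h : lipSup f ≠ ∞) :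
    LipschitzWith (lipSup f).toNNReal f :=
  lipSup_le_coe_iff.1 (ENNReal.coe_toNNReal h).ge

theorem lipSup_add_le (f g : X → E) : lipSup (f + g) ≤ lipSup f + lipSup g := by
  by_cases hf : lipSup f = ∞
  · simp [hf]
  by_cases hg : lipSup g = ∞
  · simp [hg]
  have h := lipSup_le_coe_iff.2 ((lipschitzWith_lipSup hf).add (lipschitzWith_lipSup hg))
  rwa [ENNReal.coe_add, ENNReal.coe_toNNReal hf, ENNReal.coe_toNNReal hg] at h

theorem lipSup_smul [NormedSpace ℝ E] (r : ℝ) (f : X → E) :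
    lipSup (r • f) = ENNReal.ofReal |r| * lipSup f := by
  simp only [lipSup, ENNReal.mul_iSup, Pi.smul_apply, ← smul_sub, norm_smul, Real.norm_eq_abs,
    mul_div_assoc, ENNReal.ofReal_mul (abs_nonneg r)]

theorem lipSup_eq_zero_iff {f : X → E} : lipSup f = 0 ↔ ∀ x y, f x = f y := by
  rw [← nonpos_iff_eq_zero, ← ENNReal.coe_zero, lipSup_le_coe_iff, lipschitzWith_iff_dist_le_mul]
  simp

theorem lipSup_prodMk (f : X → E) (g : X → F) :
    lipSup (fun x => (f x, g x)) = max (lipSup f) (lipSup g) := by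
  simp only [lipSup, ← iSup_sup_eq, ← ENNReal.ofReal_max, max_div_div_right dist_nonneg,
    Prod.mk_sub_mk, Prod.norm_mk]

theorem isLipschitzSeminorm_lipSup {A : Type*} [AddCommGroup A] [Module ℝ A] [One A]
    [NormedSpace ℝ E] (Φ : A →ₗ[ℝ] X → E) (hfin : ∀ a, lipSup (Φ a) ≠ ∞)
    (hker : ∀ a, (∀ x y, Φ a x = Φ a y) ↔ ∃ r : ℝ, a = r • (1 : A)) :
    IsLipschitzSeminorm fun a => lipSup (Φ a) where
  ne_top := hfin
  add_le a b := by
    simp only [map_add]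
    exact lipSup_add_le _ _
  smul_eq r a := by
    simp only [map_smul]
    exact lipSup_smul _ _
  eq_zero_iff a := lipSup_eq_zero_iff.trans (hker a)

theorem isCompact_setOf_lipschitzWith_apply_eq {Y : Type*} [MetricSpace Y] [ProperSpace Y]
    (K : ℝ≥0) (x₀ : X) (y₀ : Y) : IsCompact {f : C(X, Y) | LipschitzWith K f ∧ f x₀ = y₀} := by
  refine ArzelaAscoli.isCompact_of_equicontinuous _ ?_
    (LipschitzWith.uniformEquicontinuous _ K fun f => f.2.1).equicontinuous
  have himage : ContinuousMap.toFun '' {f : C(X, Y) | LipschitzWith K f ∧ f x₀ = y₀} =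
      {f | LipschitzWith K f} ∩ {f | f x₀ = y₀} := by
    ext f
    constructor
    · rintro ⟨f, hf, rfl⟩
      exact hf
    · exact fun hf => ⟨⟨f, hf.1.continuous⟩, hf, rfl⟩
  rw [himage]
  refine (isCompact_univ_pi fun x => isCompact_closedBall y₀ (K * dist x x₀)).of_isClosed_subset
    ((isClosed_setOfPred_lipschitzWith K).inter (isClosed_eq (continuous_apply x₀)
      continuous_const)) ?_
  rintro f ⟨hf, rfl⟩ x -
  exact hf.dist_le_mul x x₀

end LipschitzConstants

theorem integrable_of_continuous {X E : Type*} [TopologicalSpace X] [CompactSpace X]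
    [MeasurableSpace X] [OpensMeasurableSpace X] [NormedAddCommGroup E] {μ : Measure X}
    [IsFiniteMeasure μ] {f : X → E} (hf : Continuous f) : Integrable f μ :=
  hf.integrable_of_hasCompactSupport (HasCompactSupport.of_compactSpace f)

section MeanDistance

variable {X E : Type*} [MetricSpace X] [CompactSpace X] [MeasurableSpace X]
  [OpensMeasurableSpace X] {μ : Measure X} [IsProbabilityMeasure μ]

theorem integral_dist_le_diam (x₀ : X) : ∫ x, dist x₀ x ∂μ ≤ Metric.diam (Set.univ : Set X) := by
  refine (integral_mono (integrable_of_continuous (by fun_prop))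
    (integrable_const (Metric.diam (Set.univ : Set X))) fun x =>
      Metric.dist_le_diam_of_mem isCompact_univ.isBounded trivial trivial).trans_eq ?_
  simp

theorem norm_integral_sub_le [NormedAddCommGroup E] [NormedSpace ℝ E] [CompleteSpace E]
    {f : X → E} {K : ℝ≥0} (hf : LipschitzWith K f) (x₀ : X) :
    ‖∫ x, f x ∂μ - f x₀‖ ≤ K * ∫ x, dist x₀ x ∂μ :=
  calc ‖∫ x, f x ∂μ - f x₀‖ = ‖∫ x, (f x - f x₀) ∂μ‖ := by
        rw [integral_sub (integrable_of_continuous hf.continuous) (integrable_const _),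
          integral_const, probReal_univ, one_smul]
    _ ≤ ∫ x, K * dist x₀ x ∂μ :=
        norm_integral_le_of_norm_le (integrable_of_continuous (by fun_prop)) <|
          .of_forall fun x => by simpa only [dist_eq_norm, dist_comm x₀] using hf.dist_le_mul x x₀
    _ = K * ∫ x, dist x₀ x ∂μ := integral_const_mul _ _

end MeanDistance

namespace LipAlg

variable {X : Type*} [MetricSpace X]

instance : IsOrderedModule ℝ (LipAlg X) := isOrderedModule_submodule _

theorem coe_one : ((1 : LipAlg X) : C(X, ℝ)) = 1 := rfl

/-- The evaluation state at a point. -/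
def evalState (x : X) : State (LipAlg X) where
  toFun f := (f : C(X, ℝ)) x
  map_add' _ _ := rfl
  map_smul' _ _ := rfl
  monotone' _ _ h := h x
  map_one' := rfl

theorem lipNorm_eq_lipSup (f : LipAlg X) : lipNorm f = lipSup (f : C(X, ℝ)) := by
  obtain ⟨K, hK⟩ := f.2
  have h : lipSup (f : C(X, ℝ)) ≠ ∞ :=
    ne_top_of_le_ne_top ENNReal.coe_ne_top (lipSup_le_coe_iff.2 hK)
  refine le_antisymm ?_ (le_iInf₂ fun K hK => lipSup_le_coe_iff.2 hK)
  exact (iInf₂_le (f := fun (K : ℝ≥0) (_ : LipschitzWith K (f : C(X, ℝ))) => (K : ℝ≥0∞)) _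
    (lipschitzWith_lipSup h)).trans (ENNReal.coe_toNNReal h).le

theorem lipNorm_ne_top (f : LipAlg X) : lipNorm f ≠ ∞ :=
  let ⟨K, hK⟩ := f.2
  ne_top_of_le_ne_top ENNReal.coe_ne_top (iInf₂_le K hK)

theorem lipNorm_le_one_iff {f : LipAlg X} : lipNorm f ≤ 1 ↔ LipschitzWith 1 (f : C(X, ℝ)) := by
  rw [lipNorm_eq_lipSup, lipSup_le_one_iff]

theorem isLipschitzSeminorm_lipNorm [Nonempty X] : IsLipschitzSeminorm (lipNorm (G := X)) := by
  let Φ : LipAlg X →ₗ[ℝ] X → ℝ := ContinuousMap.coeFnLinearMap ℝ ∘ₗ (LipAlg X).subtype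
  obtain ⟨o⟩ := ‹Nonempty X›
  have hker (f : LipAlg X) : (∀ x y, Φ f x = Φ f y) ↔ ∃ r : ℝ, f = r • (1 : LipAlg X) := by
    refine ⟨fun h => ⟨Φ f o, Subtype.ext <| ContinuousMap.ext fun x =>
      (h x o).trans (mul_one _).symm⟩, ?_⟩
    rintro ⟨r, rfl⟩ _ _
    rfl
  rw [show lipNorm = fun f => lipSup (Φ f) from funext lipNorm_eq_lipSup]
  exact isLipschitzSeminorm_lipSup Φ
    (fun f => (lipNorm_eq_lipSup f).symm.trans_ne (lipNorm_ne_top f)) hker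

variable [CompactSpace X]

theorem orderBounded_of_norm_le (f : LipAlg X) (r : ℝ) (hf : ‖f‖ ≤ r) : OrderBounded f r :=
  have hle (g : C(X, ℝ)) (hg : ‖g‖ ≤ r) : g ≤ r • (1 : C(X, ℝ)) := fun x =>
    (g.apply_le_norm x).trans (hg.trans_eq (mul_one r).symm)
  ⟨hle f hf, hle (-f) ((norm_neg (f : C(X, ℝ))).trans_le hf)⟩

theorem isQuantumMetricSpace [Nonempty X] : IsQuantumMetricSpace (lipNorm (G := X)) := by
  have := OrderUnitSpace.of_norm (A := LipAlg X) orderBounded_of_norm_le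
  obtain ⟨o⟩ := ‹Nonempty X›
  have htb : TotallyBounded {f : LipAlg X | LipschitzWith 1 (f : C(X, ℝ)) ∧ (f : C(X, ℝ)) o = 0} :=
    totallyBounded_preimage (isUniformEmbedding_subtype_val (p := (· ∈ LipAlg X))).isUniformInducing
      (isCompact_setOf_lipschitzWith_apply_eq 1 o 0).totallyBounded
  refine IsLipschitzSeminorm.isQuantumMetricSpace (A := LipAlg X) isLipschitzSeminorm_lipNorm
    orderBounded_of_norm_le htb fun f hf => ⟨(f : C(X, ℝ)) o, ?_⟩
  have hsub : ∀ x, ((f - (f : C(X, ℝ)) o • (1 : LipAlg X) : LipAlg X) : C(X, ℝ)) x =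
      (f : C(X, ℝ)) x - (f : C(X, ℝ)) o := fun x => by simp [coe_one]
  refine ⟨LipschitzWith.of_dist_le_mul fun x y => ?_, (hsub o).trans (sub_self _)⟩
  simpa only [hsub, dist_sub_right] using (lipNorm_le_one_iff.1 hf).dist_le_mul x y

end LipAlg

section RankOneAverages

variable {X E : Type*} [TopologicalSpace X] [CompactSpace X] [MeasurableSpace X]
  [OpensMeasurableSpace X] [NormedAddCommGroup E] [InnerProductSpace ℂ E]
  {μ : Measure X} [IsProbabilityMeasure μ] {u : X → E}

/-- The average `∫ |u x⟩⟨u x| dμ` of the rank one operators along a family of vectors; along an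
orbit of a unitary representation it is a compact intertwiner. -/
def rankOneAverage (μ : Measure X) (u : X → E) : E →L[ℂ] E :=
  ∫ x, InnerProductSpace.rankOne ℂ (u x) (u x) ∂μ

theorem integrable_rankOne (hu : Continuous u) :
    Integrable (fun x => InnerProductSpace.rankOne ℂ (u x) (u x)) μ :=
  integrable_of_continuous <| ((ContinuousLinearMap.smulRightL ℂ E E).continuous.comp
    ((innerSL ℂ).continuous.comp hu)).clm_apply hu

theorem rankOneAverage_apply (hu : Continuous u) (w : E) :
    rankOneAverage μ u w = ∫ x, inner ℂ (u x) w • u x ∂μ :=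
  ContinuousLinearMap.integral_apply (integrable_rankOne hu) w

variable [CompleteSpace E]

theorem isCompactOperator_rankOneAverage (hu : Continuous u) :
    IsCompactOperator (rankOneAverage μ u) := by
  have hconvex : Convex ℝ {T : E →L[ℂ] E | IsCompactOperator T} :=
    fun S hS T hT a b _ _ _ => (hS.smul a).add (hT.smul b)
  refine hconvex.integral_mem isClosed_setOfPred_isCompactOperator (.of_forall fun x => ?_)
    (integrable_rankOne hu)
  exact (isCompactOperator_of_locallyCompactSpace_rng
    (ContinuousLinearMap.toSpanSingleton ℂ (u x))).comp_clm (innerSL ℂ (u x))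

theorem isSymmetric_rankOneAverage (hu : Continuous u) : (rankOneAverage μ u).IsSymmetric := by
  have hconvex : Convex ℝ {T : E →L[ℂ] E | IsSelfAdjoint T} :=
    fun S hS T hT a b _ _ _ => ((IsSelfAdjoint.all a).smul hS).add ((IsSelfAdjoint.all b).smul hT)
  have hclosed : IsClosed {T : E →L[ℂ] E | IsSelfAdjoint T} :=
    isClosed_eq continuous_star continuous_id
  refine ContinuousLinearMap.isSelfAdjoint_iff_isSymmetric.1 (hconvex.integral_mem hclosed
    (.of_forall fun x => ?_) (integrable_rankOne hu))
  exact ContinuousLinearMap.isSelfAdjoint_iff_isSymmetric.2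
    (InnerProductSpace.isSymmetric_rankOne_self _)

theorem inner_rankOneAverage_self (hu : Continuous u) (w : E) :
    inner ℂ w (rankOneAverage μ u w) = ((∫ x, ‖inner ℂ (u x) w‖ ^ 2 ∂μ : ℝ) : ℂ) := by
  rw [rankOneAverage_apply hu, ← integral_inner (integrable_of_continuous (by fun_prop)),
    ← integral_complex_ofReal]
  refine integral_congr_ae (.of_forall fun x => ?_)
  simp only [inner_smul_right, Complex.ofReal_pow]
  rw [← inner_conj_symm w, Complex.mul_conj']

theorem rankOneAverage_ne_zero [μ.IsOpenPosMeasure] (hu : Continuous u) {x : X} (hx : u x ≠ 0) :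
    rankOneAverage μ u ≠ 0 := by
  have hpos : 0 < ∫ y, ‖inner ℂ (u y) (u x)‖ ^ 2 ∂μ :=
    Continuous.integral_pos_of_hasCompactSupport_nonneg_nonzero (x := x) (by fun_prop)
      (HasCompactSupport.of_compactSpace _) (fun y => sq_nonneg _) (by simpa using hx)
  intro h
  have hself := inner_rankOneAverage_self (μ := μ) hu (u x)
  rw [h, zero_apply, inner_zero_right, eq_comm, Complex.ofReal_eq_zero] at hself
  exact hpos.ne' hself

end RankOneAverages

section UnitaryRepresentations

variable {G E : Type*} [Group G] [NormedAddCommGroup E] [InnerProductSpace ℂ E] [CompleteSpace E]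
  (ρ : G →* unitary (E →L[ℂ] E))

theorem adjoint_unitaryRep (g : G) :
    ContinuousLinearMap.adjoint (ρ g : E →L[ℂ] E) = (ρ g⁻¹ : E →L[ℂ] E) := by
  rw [map_inv]
  rfl

theorem unitaryRep_mul_apply (g h : G) (v : E) :
    (ρ (g * h) : E →L[ℂ] E) v = (ρ g : E →L[ℂ] E) ((ρ h : E →L[ℂ] E) v) := by
  rw [map_mul]
  rfl

variable {ρ} [TopologicalSpace G] [ContinuousMul G] [CompactSpace G] [MeasurableSpace G]
  [BorelSpace G] {μ : Measure G} [IsProbabilityMeasure μ] [μ.IsMulLeftInvariant]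

theorem unitaryRep_rankOneAverage {v : E}
    (hv : Continuous fun g => (ρ g : E →L[ℂ] E) v) (h : G) (w : E) :
    (ρ h : E →L[ℂ] E) (rankOneAverage μ (fun g => (ρ g : E →L[ℂ] E) v) w) =
      rankOneAverage μ (fun g => (ρ g : E →L[ℂ] E) v) ((ρ h : E →L[ℂ] E) w) := by
  rw [rankOneAverage_apply hv, rankOneAverage_apply hv, ← ContinuousLinearMap.integral_comp_comm _
    (integrable_of_continuous (by fun_prop)), ← integral_mul_left_eq_self
      (fun g => inner ℂ ((ρ g : E →L[ℂ] E) v) ((ρ h : E →L[ℂ] E) w) • (ρ g : E →L[ℂ] E) v) h]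
  refine integral_congr_ae (.of_forall fun g => ?_)
  simp only [map_smul]
  rw [← ContinuousLinearMap.adjoint_inner_left, adjoint_unitaryRep, ← unitaryRep_mul_apply,
    ← unitaryRep_mul_apply, inv_mul_cancel_left]

theorem exists_finiteDimensional_invariant [μ.IsOpenPosMeasure] [Nontrivial E]
    (hρ : ∀ v, Continuous fun g => (ρ g : E →L[ℂ] E) v) :
    ∃ W : Submodule ℂ E, FiniteDimensional ℂ W ∧ W ≠ ⊥ ∧
      ∀ g, ∀ v ∈ W, (ρ g : E →L[ℂ] E) v ∈ W := by
  obtain ⟨v, hv⟩ := exists_ne (0 : E)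
  set T := rankOneAverage μ fun g => (ρ g : E →L[ℂ] E) v
  have hcompact : IsCompactOperator T := isCompactOperator_rankOneAverage (hρ v)
  have hT : T ≠ 0 := rankOneAverage_ne_zero (hρ v) (x := 1) (by simpa using hv)
  obtain ⟨c, hc, hc0⟩ : ∃ c, Module.End.HasEigenvalue (T : Module.End ℂ E) c ∧ c ≠ 0 := by
    by_contra! h
    exact hT ((ContinuousLinearMap.eq_zero_of_forall_hasEigenvalue_eq_zero hcompact
      (isSymmetric_rankOneAverage (hρ v))).1 h)
  refine ⟨Module.End.eigenspace (T : Module.End ℂ E) c,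
    ContinuousLinearMap.finite_dimensional_eigenspace hcompact c hc0, hc, fun g w hw => ?_⟩
  have hw' : T w = c • w := Module.End.mem_eigenspace_iff.1 hw
  refine Module.End.mem_eigenspace_iff.2 ?_
  calc T ((ρ g : E →L[ℂ] E) w) = (ρ g : E →L[ℂ] E) (T w) :=
        (unitaryRep_rankOneAverage (hρ v) g w).symm
    _ = c • (ρ g : E →L[ℂ] E) w := by rw [hw', map_smul]

end UnitaryRepresentations

section MatrixCoefficients

theorem UnitaryIrrep.finiteDimensional {G : Type u} [Group G] [TopologicalSpace G]
    [IsTopologicalGroup G] [CompactSpace G] (π : UnitaryIrrep G) : FiniteDimensional ℂ π.E := by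
  borelize G
  let μ : Measure G := Measure.haarMeasure ⊤
  have : IsProbabilityMeasure μ := ⟨Measure.haarMeasure_self⟩
  have := π.nontrivial
  obtain ⟨W, hfin, hne, hW⟩ := exists_finiteDimensional_invariant (μ := μ) π.continuous_rep
  obtain rfl : W = ⊤ :=
    (π.irreducible W (Submodule.closed_of_finiteDimensional W) hW).resolve_left hne
  exact Module.Finite.equiv Submodule.topEquiv

variable {G : Type u} [Group G] [MetricSpace G] [IsIsometricSMul G G] [IsIsometricSMul Gᵐᵒᵖ G]

theorem matrixCoeff_of_equiv {π π' : UnitaryIrrep G} (e : π.E ≃ₗᵢ[ℂ] π'.E)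
    (he : ∀ (g : G) (v : π.E),
      e ((π.rep g : π.E →L[ℂ] π.E) v) = (π'.rep g : π'.E →L[ℂ] π'.E) (e v)) (ξ η : π.E) :
    matrixCoeff π ξ η = matrixCoeff π' (e ξ) (e η) := by
  ext x
  simp only [matrixCoeff, ContinuousMap.coe_mk, ← he, LinearIsometryEquiv.inner_map_map]

/-- The span `E_π ⊗ E_π^*` of the matrix coefficients of `π`, as a space of continuous
functions. -/
def coeffSpace (π : UnitaryIrrep G) : Submodule ℂ C(G, ℂ) :=
  Submodule.span ℂ (Set.range fun v : π.E × π.E => matrixCoeff π v.1 v.2)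

theorem coeffSpace_le_of_equiv {π π' : UnitaryIrrep G} (h : π ≈ π') :
    coeffSpace π ≤ coeffSpace π' := by
  obtain ⟨e, he⟩ := h
  refine Submodule.span_mono ?_
  rintro _ ⟨v, rfl⟩
  exact ⟨(e v.1, e v.2), (matrixCoeff_of_equiv e he v.1 v.2).symm⟩

theorem matrixCoeff_eq_sum_basis (π : UnitaryIrrep G) {ι : Type*} [Fintype ι]
    (b : Module.Basis ι ℂ π.E) (ξ η : π.E) :
    matrixCoeff π ξ η = ∑ i, ∑ j,
      ((starRingEnd ℂ) (b.repr ξ i) * b.repr η j) • matrixCoeff π (b i) (b j) := by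
  ext x
  conv_lhs => rw [← b.sum_repr ξ, ← b.sum_repr η]
  simp only [matrixCoeff, ContinuousMap.coe_mk, map_sum, map_smul, sum_inner, inner_sum,
    inner_smul_left, inner_smul_right, ContinuousMap.coe_sum, ContinuousMap.coe_smul,
    Finset.sum_apply, Pi.smul_apply, smul_eq_mul, mul_assoc, Finset.mul_sum]
  rw [Finset.sum_comm]
  simp only [mul_left_comm]

instance finiteDimensional_coeffSpace [CompactSpace G] (π : UnitaryIrrep G) :
    FiniteDimensional ℂ (coeffSpace π) := by
  have := π.finiteDimensional
  let b := Module.finBasis ℂ π.E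
  let B := Set.range fun p : Fin _ × Fin _ => matrixCoeff π (b p.1) (b p.2)
  have hB : FiniteDimensional ℂ (Submodule.span ℂ B) :=
    FiniteDimensional.span_of_finite ℂ (Set.finite_range _)
  have hle : coeffSpace π ≤ Submodule.span ℂ B := by
    refine Submodule.span_le.2 ?_
    rintro _ ⟨⟨ξ, η⟩, rfl⟩
    change matrixCoeff π ξ η ∈ Submodule.span ℂ B
    rw [matrixCoeff_eq_sum_basis π b]
    exact Submodule.sum_mem _ fun i _ => Submodule.sum_mem _ fun j _ =>
      Submodule.smul_mem _ _ (Submodule.subset_span ⟨(i, j), rfl⟩)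
  exact Submodule.finiteDimensional_of_le hle

instance finiteDimensional_truncSpace [CompactSpace G] [MeasurableSpace G] [BorelSpace G]
    (Λ : Finset (UnitaryDual G)) : FiniteDimensional ℂ (truncSpace Λ) := by
  let F (ν : UnitaryDual G) : Submodule ℂ (L2 G) :=
    (coeffSpace ν.out).map (ContinuousMap.toLp 2 (haarProb G) ℂ).toLinearMap
  have hF (ν : UnitaryDual G) : FiniteDimensional ℂ (F ν) := Module.Finite.map _ _
  have hsup : FiniteDimensional ℂ (Λ.sup F : Submodule ℂ (L2 G)) :=
    Submodule.finiteDimensional_finset_sup Λ F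
  have hle : truncSpace Λ ≤ Λ.sup F := by
    refine Submodule.topologicalClosure_minimal _ (Submodule.span_le.2 ?_)
      (Submodule.closed_of_finiteDimensional _)
    rintro _ ⟨π, ξ, η, hπ, rfl⟩
    refine Finset.le_sup (f := F) hπ (Submodule.mem_map_of_mem ?_)
    exact coeffSpace_le_of_equiv (Quotient.exact (Quotient.out_eq _).symm)
      (Submodule.subset_span ⟨(ξ, η), rfl⟩)
  exact Submodule.finiteDimensional_of_le hle

end MatrixCoefficients

section Conjugation

variable {H : Type*} [NormedAddCommGroup H] [InnerProductSpace ℂ H] [CompleteSpace H]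

theorem commute_starProjection {W : Submodule ℂ H} [W.HasOrthogonalProjection] {U : H →L[ℂ] H}
    (hU : ∀ w ∈ W, U w ∈ W) (hU' : ∀ w ∈ W, ContinuousLinearMap.adjoint U w ∈ W) :
    Commute U W.starProjection := by
  ext1 ψ
  refine (Submodule.eq_starProjection_of_mem_of_inner_eq_zero
    (hU _ (Submodule.starProjection_apply_mem _ ψ)) fun w hw => ?_).symm
  change inner ℂ (U ψ - U (W.starProjection ψ)) w = 0
  rw [← map_sub, ← ContinuousLinearMap.adjoint_inner_right]
  exact Submodule.starProjection_inner_eq_zero ψ _ (hU' w hw)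

theorem le_norm_smul_one_of_isSelfAdjoint {T : H →L[ℂ] H} (hT : IsSelfAdjoint T) :
    T ≤ (‖T‖ : ℂ) • (1 : H →L[ℂ] H) :=
  hT.le_algebraMap_norm_self.trans_eq <| by
    rw [Algebra.algebraMap_eq_smul_one, Complex.coe_smul]

-- `L²` carries its own real scalar multiplication, so the real structure on `H` is kept arbitrary.
variable [NormedSpace ℝ H] [IsScalarTower ℝ ℂ H] [SMulCommClass ℂ ℝ H]

instance isOrderedModule_continuousLinearMap : IsOrderedModule ℝ (H →L[ℂ] H) :=
  IsOrderedModule.of_smul_nonneg fun r hr T hT => by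
    rw [ContinuousLinearMap.nonneg_iff_isPositive] at hT ⊢
    rw [← algebraMap_smul ℂ r T]
    exact hT.smul_of_nonneg (Complex.zero_le_real.2 hr)

theorem le_smul_one_of_isSelfAdjoint {T : H →L[ℂ] H} (hT : IsSelfAdjoint T) {r : ℝ}
    (hr : ‖T‖ ≤ r) : T ≤ r • (1 : H →L[ℂ] H) :=
  calc T ≤ ((‖T‖ : ℝ) : ℂ) • (1 : H →L[ℂ] H) := le_norm_smul_one_of_isSelfAdjoint hT
    _ = ‖T‖ • (1 : H →L[ℂ] H) := algebraMap_smul ℂ ‖T‖ 1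
    _ ≤ r • (1 : H →L[ℂ] H) := smul_le_smul_of_nonneg_right hr zero_le_one

/-- Conjugation `T ↦ U T U^*`. -/
def conjugation (U : H →L[ℂ] H) : (H →L[ℂ] H) →ₗ[ℝ] (H →L[ℂ] H) where
  toFun T := U ∘L T ∘L ContinuousLinearMap.adjoint U
  map_add' S T := by simp
  map_smul' r T := by simp

theorem conjugation_mono (U : H →L[ℂ] H) : Monotone (conjugation U) := fun S T h => by
  have := star_right_conjugate_le_conjugate h U
  rwa [mul_assoc, mul_assoc] at this

theorem norm_conjugation_le {U : H →L[ℂ] H} (hU : ‖U‖ ≤ 1) (T : H →L[ℂ] H) :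
    ‖conjugation U T‖ ≤ ‖T‖ :=
  calc ‖U * (T * star U)‖ ≤ ‖U‖ * (‖T‖ * ‖star U‖) :=
        (norm_mul_le _ _).trans (by gcongr; exact norm_mul_le _ _)
    _ ≤ 1 * (‖T‖ * 1) := by
        rw [norm_star]
        gcongr
    _ = ‖T‖ := by ring

theorem conjugation_eq_of_semiconjBy {U S T : H →L[ℂ] H} (hU : U * star U = 1)
    (h : SemiconjBy U S T) : conjugation U S = T := by
  change U * (S * star U) = T
  rw [← mul_assoc, h.eq, mul_assoc, hU, mul_one]

end Conjugation

section Translations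

variable {G : Type u} [Group G] [MetricSpace G] [IsIsometricSMul G G] [IsIsometricSMul Gᵐᵒᵖ G]

/-- Left translation `x ↦ f (g x)`, as a continuous function of `g`. -/
def leftTranslate (f : C(G, ℝ)) : C(G, C(G, ℝ)) :=
  ContinuousMap.curry ⟨fun p : G × G => f (p.1 * p.2), by fun_prop⟩

/-- Right translation `x ↦ f (x g)`, as a continuous function of `g`. -/
def rightTranslate (f : C(G, ℝ)) : C(G, C(G, ℝ)) :=
  ContinuousMap.curry ⟨fun p : G × G => f (p.2 * p.1), by fun_prop⟩

theorem leftTranslate_apply (f : C(G, ℝ)) (g x : G) : leftTranslate f g x = f (g * x) := rfl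

theorem rightTranslate_apply (f : C(G, ℝ)) (g x : G) : rightTranslate f g x = f (x * g) := rfl

theorem leftTranslate_one (f : C(G, ℝ)) : leftTranslate f 1 = f :=
  ContinuousMap.ext fun x => by rw [leftTranslate_apply, one_mul]

theorem rightTranslate_one (f : C(G, ℝ)) : rightTranslate f 1 = f :=
  ContinuousMap.ext fun x => by rw [rightTranslate_apply, mul_one]

variable [CompactSpace G] {f : C(G, ℝ)} {K : ℝ≥0}

theorem lipschitzWith_leftTranslate (hf : LipschitzWith K f) : LipschitzWith K (leftTranslate f) :=
  LipschitzWith.of_dist_le_mul fun x y => (ContinuousMap.dist_le (by positivity)).2 fun z => by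
    simpa only [leftTranslate_apply, dist_mul_right] using hf.dist_le_mul (x * z) (y * z)

theorem lipschitzWith_rightTranslate (hf : LipschitzWith K f) :
    LipschitzWith K (rightTranslate f) :=
  LipschitzWith.of_dist_le_mul fun x y => (ContinuousMap.dist_le (by positivity)).2 fun z => by
    simpa only [rightTranslate_apply, dist_mul_left] using hf.dist_le_mul (z * x) (z * y)

variable [MeasurableSpace G] [BorelSpace G]

theorem integral_leftTranslate_apply (f : C(G, ℝ)) (μ : Measure G) [IsFiniteMeasure μ] (z : G) :
    (∫ x, leftTranslate f x ∂μ) z = ∫ x, f (x * z) ∂μ :=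
  (ContinuousLinearMap.integral_comp_comm (μ := μ) (ContinuousMap.evalCLM ℝ z)
    (integrable_of_continuous (leftTranslate f).continuous)).symm

theorem integral_rightTranslate (f : C(G, ℝ)) (μ : Measure G) [IsFiniteMeasure μ]
    [μ.IsMulLeftInvariant] :
    ∫ x, rightTranslate f x ∂μ = (∫ x, f x ∂μ) • (1 : C(G, ℝ)) := by
  ext z
  calc (∫ x, rightTranslate f x ∂μ) z = ∫ x, f (z * x) ∂μ :=
        (ContinuousLinearMap.integral_comp_comm (μ := μ) (ContinuousMap.evalCLM ℝ z)
          (integrable_of_continuous (rightTranslate f).continuous)).symm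
    _ = ∫ x, f x ∂μ := integral_mul_left_eq_self f z
    _ = ((∫ x, f x ∂μ) • (1 : C(G, ℝ))) z := (mul_one _).symm

end Translations

section MultiplicationOperators

variable {G : Type u} [Group G] [MetricSpace G] [IsIsometricSMul G G] [IsIsometricSMul Gᵐᵒᵖ G]
  [CompactSpace G] [MeasurableSpace G] [BorelSpace G]

theorem coeFn_mulOp (f : C(G, ℝ)) (ψ : L2 G) :
    mulOp f ψ =ᵐ[haarProb G] fun x => (f x : ℂ) * ψ x := by
  refine (ContinuousLinearMap.coeFn_holder _ _ _).trans ?_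
  filter_upwards [ContinuousMap.coeFn_toLp (p := ∞) (𝕜 := ℂ) (haarProb G)
    ((⟨Complex.ofReal, Complex.continuous_ofReal⟩ : C(ℝ, ℂ)).comp f)] with x hx
  rw [hx]
  rfl

theorem norm_mulOp_le (f : C(G, ℝ)) : ‖mulOp f‖ ≤ ‖f‖ := by
  refine ContinuousLinearMap.opNorm_le_bound _ (norm_nonneg f) fun ψ => ?_
  refine Lp.norm_le_mul_norm_of_ae_le_mul ?_
  filter_upwards [coeFn_mulOp f ψ] with x hx
  rw [hx, norm_mul, Complex.norm_real]
  gcongr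
  exact f.norm_coe_le_norm x

theorem isSelfAdjoint_mulOp (f : C(G, ℝ)) : IsSelfAdjoint (mulOp f) := by
  refine ContinuousLinearMap.isSelfAdjoint_iff_isSymmetric.2 fun ψ φ => ?_
  change inner ℂ (mulOp f ψ) φ = inner ℂ ψ (mulOp f φ)
  rw [L2.inner_def, L2.inner_def]
  refine integral_congr_ae ?_
  filter_upwards [coeFn_mulOp f ψ, coeFn_mulOp f φ] with x hψ hφ
  rw [hψ, hφ]
  simp only [RCLike.inner_apply, map_mul, Complex.conj_ofReal]
  ring

theorem mulOp_mul (f g : C(G, ℝ)) : mulOp (f * g) = mulOp f * mulOp g := by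
  ext1 ψ
  apply Lp.ext
  filter_upwards [coeFn_mulOp (f * g) ψ, coeFn_mulOp f (mulOp g ψ), coeFn_mulOp g ψ]
    with x hfg hf hg
  rw [hfg, mul_apply_eq_comp, hf, hg, ContinuousMap.mul_apply, Complex.ofReal_mul,
    mul_assoc]

theorem mulOp_nonneg {f : C(G, ℝ)} (hf : 0 ≤ f) : 0 ≤ mulOp f := by
  obtain ⟨s, rfl⟩ : ∃ s : C(G, ℝ), f = s * s :=
    ⟨⟨fun x => √(f x), by fun_prop⟩, ContinuousMap.ext fun x => (Real.mul_self_sqrt (hf x)).symm⟩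
  rw [mulOp_mul]
  exact (isSelfAdjoint_mulOp s).mul_self_nonneg

theorem mulOp_mono : Monotone (mulOp (G := G)) := fun f g h => by
  rw [← sub_nonneg, ← map_sub]
  exact mulOp_nonneg (sub_nonneg.2 h)

end MultiplicationOperators

section LeftRegularRepresentation

variable {G : Type u} [Group G] [MetricSpace G] [IsIsometricSMul G G] [IsIsometricSMul Gᵐᵒᵖ G]
  [CompactSpace G] [MeasurableSpace G] [BorelSpace G]

theorem coeFn_leftReg (g : G) (ψ : L2 G) :
    leftReg g ψ =ᵐ[haarProb G] fun x => ψ (g⁻¹ * x) :=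
  Lp.coeFn_compMeasurePreserving ψ (measurePreserving_mul_left (haarProb G) g⁻¹)

theorem leftReg_mul_inv (g : G) : leftReg g * leftReg g⁻¹ = 1 := by
  ext1 ψ
  apply Lp.ext
  refine (coeFn_leftReg g (leftReg g⁻¹ ψ)).trans ?_
  filter_upwards [(measurePreserving_mul_left (haarProb G) g⁻¹).quasiMeasurePreserving.ae
    (coeFn_leftReg g⁻¹ ψ)] with x hx
  simpa using hx

theorem star_leftReg (g : G) : star (leftReg g) = leftReg g⁻¹ := by
  have hiso : star (leftReg g) * leftReg g = 1 :=
    (ContinuousLinearMap.norm_map_iff_adjoint_comp_self _).1 fun ψ =>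
      (Lp.compMeasurePreservingₗᵢ ℂ (fun x : G => g⁻¹ * x)
        (measurePreserving_mul_left (haarProb G) g⁻¹)).norm_map ψ
  exact left_inv_eq_right_inv hiso (leftReg_mul_inv g)

theorem leftReg_toLp (g : G) (φ : C(G, ℂ)) :
    leftReg g (ContinuousMap.toLp 2 (haarProb G) ℂ φ) =
      ContinuousMap.toLp 2 (haarProb G) ℂ (φ.comp ⟨fun x => g⁻¹ * x, by fun_prop⟩) := by
  apply Lp.ext
  filter_upwards [coeFn_leftReg g (ContinuousMap.toLp 2 (haarProb G) ℂ φ),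
    (measurePreserving_mul_left (haarProb G) g⁻¹).quasiMeasurePreserving.ae
      (ContinuousMap.coeFn_toLp (p := 2) (𝕜 := ℂ) (haarProb G) φ),
    ContinuousMap.coeFn_toLp (p := 2) (𝕜 := ℂ) (haarProb G)
      (φ.comp ⟨fun x => g⁻¹ * x, by fun_prop⟩)] with x hU hφ hφg
  rw [hU, hφ, hφg]
  rfl

theorem leftReg_mem_truncSpace (Λ : Finset (UnitaryDual G)) (g : G) {ψ : L2 G}
    (hψ : ψ ∈ truncSpace Λ) : leftReg g ψ ∈ truncSpace Λ := by
  refine map_mem_closure (leftReg g).continuous hψ fun φ hφ => ?_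
  refine (Submodule.span_le (p := (Submodule.span ℂ _).comap (leftReg g).toLinearMap)).2 ?_ hφ
  rintro _ ⟨π, ξ, η, hπ, rfl⟩
  refine Submodule.subset_span ⟨π, ξ, (π.rep g : π.E →L[ℂ] π.E) η, hπ, ?_⟩
  refine (leftReg_toLp g _).trans (congrArg _ (ContinuousMap.ext fun x => ?_))
  simp only [matrixCoeff, ContinuousMap.comp_apply, ContinuousMap.coe_mk, mul_inv_rev, inv_inv,
    unitaryRep_mul_apply]

theorem commute_leftReg_truncProj (Λ : Finset (UnitaryDual G)) (g : G) :
    Commute (leftReg g) (truncProj Λ) :=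
  commute_starProjection (fun _ => leftReg_mem_truncSpace Λ g) <| by
    rw [← ContinuousLinearMap.star_eq_adjoint, star_leftReg]
    exact fun _ => leftReg_mem_truncSpace Λ g⁻¹

theorem semiconjBy_leftReg_mulOp (g : G) (f : C(G, ℝ)) :
    SemiconjBy (leftReg g) (mulOp f) (mulOp (leftTranslate f g⁻¹)) := by
  ext1 ψ
  apply Lp.ext
  refine (coeFn_leftReg g _).trans ?_
  have hq := (measurePreserving_mul_left (haarProb G) g⁻¹).quasiMeasurePreserving
  filter_upwards [hq.ae (coeFn_mulOp f ψ), coeFn_mulOp (leftTranslate f g⁻¹) (leftReg g ψ),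
    coeFn_leftReg g ψ] with x hf hfg hU
  rw [mul_apply_eq_comp, hfg, hU, leftTranslate_apply]
  exact hf

end LeftRegularRepresentation

section ToeplitzOperators

variable {G : Type u} [Group G] [MetricSpace G] [IsIsometricSMul G G] [IsIsometricSMul Gᵐᵒᵖ G]
  [CompactSpace G] [MeasurableSpace G] [BorelSpace G] (Λ : Finset (UnitaryDual G))

theorem isSelfAdjoint_truncProj : IsSelfAdjoint (truncProj Λ) :=
  isSelfAdjoint_starProjection _

theorem truncProj_mul_self : truncProj Λ * truncProj Λ = truncProj Λ :=
  (truncSpace Λ).isIdempotentElem_starProjection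

theorem compress_eq_conjugation : compress Λ = conjugation (truncProj Λ) :=
  LinearMap.ext fun T => congrArg (fun P => truncProj Λ * (T * P)) (isSelfAdjoint_truncProj Λ).symm

theorem compress_mono : Monotone (compress Λ) :=
  compress_eq_conjugation Λ ▸ conjugation_mono (truncProj Λ)

theorem norm_compress_le (T : L2 G →L[ℂ] L2 G) : ‖compress Λ T‖ ≤ ‖T‖ :=
  compress_eq_conjugation Λ ▸ norm_conjugation_le (Submodule.starProjection_norm_le _) T

theorem compress_compress (T : L2 G →L[ℂ] L2 G) : compress Λ (compress Λ T) = compress Λ T := by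
  change truncProj Λ * ((truncProj Λ * (T * truncProj Λ)) * truncProj Λ) =
    truncProj Λ * (T * truncProj Λ)
  rw [mul_assoc, mul_assoc, truncProj_mul_self, ← mul_assoc, truncProj_mul_self]

theorem compress_one : compress Λ 1 = truncProj Λ := truncProj_mul_self Λ

/-- The map `f ↦ P_Λ f P_Λ` on all continuous functions, as a bounded operator; it is `τ_Λ` on
Lipschitz functions. -/
def toeplitz : C(G, ℝ) →L[ℝ] (L2 G →L[ℂ] L2 G) :=
  (compress Λ ∘ₗ mulOp).mkContinuous 1 fun f =>
    ((norm_compress_le Λ (mulOp f)).trans (norm_mulOp_le f)).trans_eq (one_mul _).symm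

theorem norm_toeplitz_le (f : C(G, ℝ)) : ‖toeplitz Λ f‖ ≤ ‖f‖ :=
  (norm_compress_le Λ (mulOp f)).trans (norm_mulOp_le f)

theorem toeplitz_one : toeplitz Λ 1 = truncProj Λ :=
  (congrArg (compress Λ) mulOp_one).trans (compress_one Λ)

theorem toeplitz_mono : Monotone (toeplitz Λ) :=
  (compress_mono Λ).comp mulOp_mono

theorem isSelfAdjoint_toeplitz (f : C(G, ℝ)) : IsSelfAdjoint (toeplitz Λ f) := by
  have h := (isSelfAdjoint_mulOp f).conjugate_self (isSelfAdjoint_truncProj Λ)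
  rwa [mul_assoc] at h

theorem toeplitz_le_smul_truncProj {f : C(G, ℝ)} {r : ℝ} (hr : ‖toeplitz Λ f‖ ≤ r) :
    toeplitz Λ f ≤ r • truncProj Λ :=
  calc toeplitz Λ f = compress Λ (toeplitz Λ f) := (compress_compress Λ (mulOp f)).symm
    _ ≤ compress Λ (r • 1) :=
        compress_mono Λ (le_smul_one_of_isSelfAdjoint (isSelfAdjoint_toeplitz Λ f) hr)
    _ = r • truncProj Λ := by rw [map_smul, compress_one]

theorem lamAct_toeplitz (g : G) (f : C(G, ℝ)) :
    lamAct g (toeplitz Λ f) = toeplitz Λ (leftTranslate f g⁻¹) := by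
  have hP : SemiconjBy (leftReg g) (truncProj Λ) (truncProj Λ) := commute_leftReg_truncProj Λ g
  refine conjugation_eq_of_semiconjBy ?_
    (hP.mul_right ((semiconjBy_leftReg_mulOp g f).mul_right hP))
  rw [star_leftReg, leftReg_mul_inv]

theorem rhoAct_toeplitz (g : G) (f : C(G, ℝ)) :
    rhoAct g (toeplitz Λ f) = toeplitz Λ (rightTranslate f g) := by
  have hP : SemiconjBy (rightReg g) (truncProj Λ) (truncProj Λ) := rightReg_comp_truncProj Λ g
  have hf : SemiconjBy (rightReg g) (mulOp f) (mulOp (rightTranslate f g)) :=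
    rightReg_comp_mulOp g f
  refine conjugation_eq_of_semiconjBy ?_ (hP.mul_right (hf.mul_right hP))
  rw [ContinuousLinearMap.star_eq_adjoint, adjoint_rightReg]
  exact rightReg_mul_inv g

theorem lipschitzWith_toeplitz : LipschitzWith 1 (toeplitz Λ) :=
  LipschitzWith.of_dist_le_mul fun f g => by
    simpa only [dist_eq_norm, NNReal.coe_one, one_mul, map_sub] using norm_toeplitz_le Λ (f - g)

theorem lipschitzWith_lamAct_toeplitz {f : C(G, ℝ)} {K : ℝ≥0} (hf : LipschitzWith K f) :
    LipschitzWith K fun g => lamAct g (toeplitz Λ f) := by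
  simpa only [lamAct_toeplitz, one_mul, mul_one, Function.comp_def] using
    (lipschitzWith_toeplitz Λ).comp ((lipschitzWith_leftTranslate hf).comp isometry_inv.lipschitz)

theorem lipschitzWith_rhoAct_toeplitz {f : C(G, ℝ)} {K : ℝ≥0} (hf : LipschitzWith K f) :
    LipschitzWith K fun g => rhoAct g (toeplitz Λ f) := by
  simpa only [rhoAct_toeplitz, one_mul, Function.comp_def] using
    (lipschitzWith_toeplitz Λ).comp (lipschitzWith_rightTranslate hf)

theorem integral_lamAct_inv_toeplitz (f : C(G, ℝ)) (μ : Measure G) [IsFiniteMeasure μ] :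
    ∫ x, lamAct x⁻¹ (toeplitz Λ f) ∂μ = toeplitz Λ (∫ x, leftTranslate f x ∂μ) := by
  simp only [lamAct_toeplitz, inv_inv]
  exact (toeplitz Λ).integral_comp_comm (integrable_of_continuous (leftTranslate f).continuous)

theorem integral_rhoAct_toeplitz (f : C(G, ℝ)) (μ : Measure G) [IsFiniteMeasure μ]
    [μ.IsMulLeftInvariant] :
    ∫ x, rhoAct x (toeplitz Λ f) ∂μ = (∫ x, f x ∂μ) • truncProj Λ := by
  simp only [rhoAct_toeplitz]
  rw [← toeplitz_one, ← map_smul, ← integral_rightTranslate]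
  exact (toeplitz Λ).integral_comp_comm (integrable_of_continuous (rightTranslate f).continuous)

end ToeplitzOperators

section TruncatedSpaces

variable {G : Type u} [Group G] [MetricSpace G] [IsIsometricSMul G G] [IsIsometricSMul Gᵐᵒᵖ G]
  [CompactSpace G] [MeasurableSpace G] [BorelSpace G] (Λ : Finset (UnitaryDual G))

theorem trunc_surjective : Function.Surjective (trunc Λ) := by
  rintro ⟨_, f, hf, rfl⟩
  exact ⟨⟨f, hf⟩, rfl⟩

theorem coe_trunc (f : LipAlg G) : (trunc Λ f : L2 G →L[ℂ] L2 G) = toeplitz Λ f := rfl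

theorem trunc_one : trunc Λ 1 = 1 := Subtype.ext (toeplitz_one Λ)

/-- The compression `τ_Λ` as an order-unit morphism. -/
def truncHom : OrderUnitHom (LipAlg G) (TruncAlg Λ) where
  toFun := trunc Λ
  map_add' f g := Subtype.ext (map_add (toeplitz Λ) (f : C(G, ℝ)) g)
  map_smul' r f := Subtype.ext (map_smul (toeplitz Λ) r (f : C(G, ℝ)))
  monotone' _ _ h := toeplitz_mono Λ h
  map_one' := trunc_one Λ

theorem truncRho_trunc (g : G) (f : LipAlg G) :
    truncRho Λ g (trunc Λ f) = trunc Λ ⟨rightTranslate f g,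
      let ⟨_, hf⟩ := f.2; ⟨_, hf.comp (isometry_mul_right g).lipschitz⟩⟩ :=
  Subtype.ext (rhoAct_toeplitz Λ g f)

theorem truncRho_one (g : G) : truncRho Λ g 1 = 1 := by
  rw [← trunc_one, truncRho_trunc]
  rfl

namespace TruncAlg

instance : IsOrderedModule ℝ (TruncAlg Λ) := isOrderedModule_submodule _

theorem orderBounded_of_norm_le (T : TruncAlg Λ) (r : ℝ) (hT : ‖T‖ ≤ r) : OrderBounded T r := by
  have hle (S : TruncAlg Λ) (hS : ‖S‖ ≤ r) : S ≤ r • (1 : TruncAlg Λ) := by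
    obtain ⟨f, rfl⟩ := trunc_surjective Λ S
    exact toeplitz_le_smul_truncProj Λ hS
  exact ⟨hle T hT, hle (-T) ((norm_neg T).trans_le hT)⟩

instance finiteDimensional : FiniteDimensional ℝ (TruncAlg Λ) := by
  let V := truncSpace Λ
  let Ψ : (V →ₗ[ℂ] V) →ₗ[ℝ] (L2 G →L[ℂ] L2 G) :=
    { toFun S := V.subtypeL ∘L LinearMap.toContinuousLinearMap S ∘L V.orthogonalProjectionOnto
      map_add' S T := by ext1; simp
      map_smul' r S := by ext1; simp }
  have hfin : FiniteDimensional ℝ (V →ₗ[ℂ] V) := Module.Finite.trans ℂ _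
  have hle : TruncAlg Λ ≤ LinearMap.range Ψ := by
    rintro _ ⟨f, -, rfl⟩
    exact ⟨(V.orthogonalProjectionOnto ∘L mulOp f ∘L V.subtypeL).toLinearMap, rfl⟩
  exact Submodule.finiteDimensional_of_le hle

/-- The orbit map `g ↦ (λ_g(T), ρ_g(T))`. Its best Lipschitz constant, for the maximum norm on
pairs, is `L_Λ(T)`. -/
def orbit : TruncAlg Λ →ₗ[ℝ] G → (L2 G →L[ℂ] L2 G) × (L2 G →L[ℂ] L2 G) :=
  LinearMap.pi fun g =>
    ((conjugation (leftReg g)).prod (conjugation (rightReg g))) ∘ₗ (TruncAlg Λ).subtype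

theorem truncLipNorm_eq_lipSup (T : TruncAlg Λ) : truncLipNorm Λ T = lipSup (orbit Λ T) :=
  (lipSup_prodMk _ _).symm

theorem truncLipNorm_trunc_le (f : LipAlg G) : truncLipNorm Λ (trunc Λ f) ≤ lipNorm f :=
  le_iInf₂ fun _ hf => max_le (lipSup_le_coe_iff.2 (lipschitzWith_lamAct_toeplitz Λ hf))
    (lipSup_le_coe_iff.2 (lipschitzWith_rhoAct_toeplitz Λ hf))

theorem truncLipNorm_ne_top (T : TruncAlg Λ) : truncLipNorm Λ T ≠ ∞ := by
  obtain ⟨f, rfl⟩ := trunc_surjective Λ T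
  exact ne_top_of_le_ne_top (LipAlg.lipNorm_ne_top f) (truncLipNorm_trunc_le Λ f)

/-- The scalar is the Haar mean of any symbol of `T`. -/
theorem exists_norm_sub_smul_one_le {T : TruncAlg Λ} {K : ℝ≥0}
    (hT : LipschitzWith K fun g => rhoAct g (T : L2 G →L[ℂ] L2 G)) :
    ∃ r : ℝ, ‖T - r • (1 : TruncAlg Λ)‖ ≤ K * Metric.diam (Set.univ : Set G) := by
  obtain ⟨f, rfl⟩ := trunc_surjective Λ T
  refine ⟨∫ x, (f : C(G, ℝ)) x ∂haarProb G, ?_⟩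
  have hdist := norm_integral_sub_le (μ := haarProb G) hT 1
  rw [coe_trunc, integral_rhoAct_toeplitz, rhoAct_toeplitz, rightTranslate_one, norm_sub_rev]
    at hdist
  exact hdist.trans (by gcongr; exact integral_dist_le_diam 1)

theorem isLipschitzSeminorm : IsLipschitzSeminorm (truncLipNorm Λ) := by
  rw [funext (truncLipNorm_eq_lipSup Λ)]
  refine isLipschitzSeminorm_lipSup (orbit Λ)
    (fun T => (truncLipNorm_eq_lipSup Λ T).symm.trans_ne (truncLipNorm_ne_top Λ T))
    fun T => ⟨fun h => ?_, ?_⟩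
  · have hρ : LipschitzWith 0 fun g => rhoAct g (T : L2 G →L[ℂ] L2 G) :=
      lipSup_le_coe_iff.1 (lipSup_eq_zero_iff.2 fun x y => congrArg Prod.snd (h x y)).le
    obtain ⟨r, hr⟩ := exists_norm_sub_smul_one_le Λ hρ
    exact ⟨r, sub_eq_zero.1 (norm_le_zero_iff.1 (hr.trans_eq (zero_mul _)))⟩
  · rintro ⟨r, rfl⟩
    have hone : truncLipNorm Λ 1 = 0 := by
      rw [← trunc_one, ← nonpos_iff_eq_zero]
      exact (truncLipNorm_trunc_le Λ 1).trans
        ((LipAlg.isLipschitzSeminorm_lipNorm.eq_zero_iff 1).2 ⟨1, (one_smul _ _).symm⟩).le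
    rw [truncLipNorm_eq_lipSup, lipSup_eq_zero_iff] at hone
    intro x y
    simp only [map_smul, Pi.smul_apply, hone x y]

theorem isQuantumMetricSpace : IsQuantumMetricSpace (truncLipNorm Λ) := by
  have := OrderUnitSpace.of_norm (A := TruncAlg Λ) (orderBounded_of_norm_le Λ)
  have := FiniteDimensional.proper ℝ (TruncAlg Λ)
  refine IsLipschitzSeminorm.isQuantumMetricSpace (A := TruncAlg Λ) (isLipschitzSeminorm Λ)
    (orderBounded_of_norm_le Λ)
    (isCompact_closedBall (0 : TruncAlg Λ) (Metric.diam (Set.univ : Set G))).totallyBounded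
    fun T hT => ?_
  obtain ⟨r, hr⟩ := exists_norm_sub_smul_one_le Λ
    (lipSup_le_one_iff.1 ((le_max_right _ _).trans hT))
  exact ⟨r, mem_closedBall_zero_iff.2 (by simpa using hr)⟩

end TruncAlg

end TruncatedSpaces

section CovariantSymbol

variable {G : Type u} [Group G] [MetricSpace G] [IsIsometricSMul G G] [IsIsometricSMul Gᵐᵒᵖ G]
  [CompactSpace G] [MeasurableSpace G] [BorelSpace G] {Λ : Finset (UnitaryDual G)}

theorem lipSup_state_truncRho_le (σ : State (TruncAlg Λ)) (T : TruncAlg Λ) :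
    lipSup (fun g => σ (truncRho Λ g T)) ≤ truncLipNorm Λ T := by
  refine le_trans ?_ (le_max_right (lamNorm (T : L2 G →L[ℂ] L2 G)) _)
  refine iSup₂_mono fun g h => iSup_mono fun _ => ENNReal.ofReal_le_ofReal ?_
  gcongr
  rw [← map_sub, Real.norm_eq_abs]
  exact σ.abs_le (TruncAlg.orderBounded_of_norm_le Λ _ _ le_rfl)

theorem lipschitzWith_state_truncRho (σ : State (TruncAlg Λ)) (T : TruncAlg Λ) :
    LipschitzWith (truncLipNorm Λ T).toNNReal fun g => σ (truncRho Λ g T) :=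
  lipSup_le_coe_iff.1 <| (lipSup_state_truncRho_le σ T).trans_eq
    (ENNReal.coe_toNNReal (TruncAlg.truncLipNorm_ne_top Λ T)).symm

/-- The morphism `T ↦ (g ↦ σ (ρ_g(T)))` attached to a state `σ` of `A_Λ`, written `υ_Λ^μ` when
`σ` is the lift of `μ`. -/
def covariantSymbol (σ : State (TruncAlg Λ)) : OrderUnitHom (TruncAlg Λ) (LipAlg G) where
  toFun T := ⟨⟨fun g => σ (truncRho Λ g T), (lipschitzWith_state_truncRho σ T).continuous⟩,
    _, lipschitzWith_state_truncRho σ T⟩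
  map_add' S T := by
    ext g
    exact (congrArg σ (Subtype.ext (map_add (conjugation (rightReg g)) _ _))).trans
      (map_add σ (truncRho Λ g S) (truncRho Λ g T))
  map_smul' r T := by
    ext g
    exact (congrArg σ (Subtype.ext (map_smul (conjugation (rightReg g)) r _))).trans
      (map_smul σ r (truncRho Λ g T))
  monotone' _ _ h g := OrderHomClass.mono σ (conjugation_mono (rightReg g) h)
  map_one' := by
    ext g
    exact (congrArg σ (truncRho_one Λ g)).trans (map_one σ)

theorem covariantSymbol_apply (σ : State (TruncAlg Λ)) (T : TruncAlg Λ) (g : G) :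
    (covariantSymbol σ T : C(G, ℝ)) g = σ (truncRho Λ g T) := rfl

theorem isLipMorphism_covariantSymbol (σ : State (TruncAlg Λ)) :
    (covariantSymbol σ).IsLipMorphism (truncLipNorm Λ) lipNorm := fun T =>
  (LipAlg.lipNorm_eq_lipSup _).trans_le (lipSup_state_truncRho_le σ T)

namespace IsLift

variable {μ : Measure G} [IsProbabilityMeasure μ] {σ : State (TruncAlg Λ)}

theorem covariantSymbol_trunc (hσ : IsLift Λ μ σ) (f : LipAlg G) :
    (covariantSymbol σ (trunc Λ f) : C(G, ℝ)) = ∫ x, leftTranslate (f : C(G, ℝ)) x ∂μ := by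
  ext g
  rw [covariantSymbol_apply, truncRho_trunc, hσ, integral_leftTranslate_apply]
  rfl

theorem trunc_covariantSymbol (hσ : IsLift Λ μ σ) (T : TruncAlg Λ) :
    (trunc Λ (covariantSymbol σ T) : L2 G →L[ℂ] L2 G) =
      ∫ x, lamAct x⁻¹ (T : L2 G →L[ℂ] L2 G) ∂μ := by
  obtain ⟨f, rfl⟩ := trunc_surjective Λ T
  rw [coe_trunc, coe_trunc, hσ.covariantSymbol_trunc, integral_lamAct_inv_toeplitz]

theorem norm_covariantSymbol_trunc_sub_le (hσ : IsLift Λ μ σ) {f : LipAlg G}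
    (hf : lipNorm f ≤ 1) :
    ‖covariantSymbol σ (trunc Λ f) - f‖ ≤ ∫ x, dist 1 x ∂μ := by
  have h := norm_integral_sub_le (μ := μ)
    (lipschitzWith_leftTranslate (LipAlg.lipNorm_le_one_iff.1 hf)) 1
  rwa [leftTranslate_one, ← hσ.covariantSymbol_trunc, NNReal.coe_one, one_mul] at h

theorem norm_trunc_covariantSymbol_sub_le (hσ : IsLift Λ μ σ) {T : TruncAlg Λ}
    (hT : truncLipNorm Λ T ≤ 1) :
    ‖trunc Λ (covariantSymbol σ T) - T‖ ≤ ∫ x, dist 1 x ∂μ := by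
  have hlam : LipschitzWith 1 fun g => lamAct g (T : L2 G →L[ℂ] L2 G) :=
    lipSup_le_one_iff.1 ((le_max_left _ _).trans hT)
  have h := norm_integral_sub_le (μ := μ) (hlam.comp isometry_inv.lipschitz) 1
  have hone : lamAct 1⁻¹ (T : L2 G →L[ℂ] L2 G) = T := by
    obtain ⟨f, rfl⟩ := trunc_surjective Λ T
    rw [coe_trunc, lamAct_toeplitz, inv_inv, leftTranslate_one]
  simp only [Function.comp_apply] at h
  rwa [← hσ.trunc_covariantSymbol, hone, mul_one, NNReal.coe_one, one_mul] at h

end IsLift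

end CovariantSymbol

end

theorem proposition4p3 {G : Type u} [Group G] [MetricSpace G] [CompactSpace G]
    [IsIsometricSMul G G] [IsIsometricSMul Gᵐᵒᵖ G] [MeasurableSpace G] [BorelSpace G]
    (Λ : Finset (UnitaryDual G)) (μ : Measure G) [IsProbabilityMeasure μ]
    (μΛ : State (TruncAlg Λ)) (hμ : IsLift Λ μ μΛ) :
    ∃ (hΛ : IsQuantumMetricSpace (truncLipNorm Λ))
      (hG : IsQuantumMetricSpace (lipNorm (G := G)))
      (_ : Nonempty (State (TruncAlg Λ))) (_ : Nonempty (State (LipAlg G))),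
      (∃ υ : OrderUnitHom (TruncAlg Λ) (LipAlg G),
        (∀ (T : TruncAlg Λ) (g : G), (υ T : C(G, ℝ)) g = μΛ (truncRho Λ g T)) ∧
          υ.IsLipMorphism (truncLipNorm Λ) lipNorm) ∧
      GromovHausdorff.ghDist (StateSpace hΛ) (StateSpace hG) ≤ ∫ x, dist 1 x ∂μ := by
  have hυ := isLipMorphism_covariantSymbol μΛ
  have hτ : (truncHom Λ).IsLipMorphism lipNorm (truncLipNorm Λ) := TruncAlg.truncLipNorm_trunc_le Λ
  have hneΛ : Nonempty (State (TruncAlg Λ)) := ⟨μΛ⟩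
  have hneG : Nonempty (State (LipAlg G)) := ⟨LipAlg.evalState 1⟩
  exact ⟨TruncAlg.isQuantumMetricSpace Λ, LipAlg.isQuantumMetricSpace, hneΛ, hneG,
    ⟨covariantSymbol μΛ, covariantSymbol_apply μΛ, hυ⟩,
    ghDist_stateSpace_le _ _ hυ hτ (integral_nonneg fun _ => dist_nonneg)
      (fun _ hT => TruncAlg.orderBounded_of_norm_le Λ _ _
        (hμ.norm_trunc_covariantSymbol_sub_le hT))
      fun _ hf => LipAlg.orderBounded_of_norm_le _ _
        (hμ.norm_covariantSymbol_trunc_sub_le hf)⟩
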